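/- Let $M$ be a finite-dimensional $C^1$ manifold without boundary, equipped with a distance that induces its topology and is, in charts, locally bi-Lipschitz equivalent to the Euclidean distance (for instance a Riemannian distance). Let $\Phi^t$, $t\in\mathbb{R}$, be a $C^1$ flow on $M$ preserving a Borel probability measure $\mu$. Assume that $\Phi^t$ has superpolynomial decay of correlations with respect to Lipschitz observables: there are a constant $C$ and a function $\alpha$ with $\lim_{t\to\infty}t^{\gamma}\alpha(t)=0$ for every $\gamma>0$ such that, for all bounded Lipschitz functions $g,h:M\to\mathbb{R}$ and all $t\ge 0$, $$\left|\int g(\Phi^t(x))\,h(x)\,d\mu-\int g\,d\mu\int h\,d\mu\right|\le C\,\|g\|\,\|h\|\,\alpha(t),$$ where $\|g\|=\sup|g|+\mathrm{Lip}(g)$. Let $V\subset M$ be an embedded $C^1$ submanifold transverse to the flow, i.e. at each $p\in V$ the generator $X(p)=\frac{d}{dt}\Phi^t(p)|_{t=0}$ is nonzero and $T_pM=T_pV\oplus\mathbb{R}X(p)$. Let $f:M\to[0,\infty)$ be Lipschitz, put $$B_l=\{x\in V: f(x)<l\},$$ and suppose that for some $l>0$ the set $B_l$ is relatively compact in $V$,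 i.e. its closure in $M$ is compact and contained in $V$. Let $$C_{\epsilon,l}=\{x\in M:\ \Phi^t(x)\in B_l\ \text{for some}\ 0\le t<\epsilon\},\qquad \tau(x,A)=\inf\{t>0:\Phi^t(x)\in A\}\in[0,\infty].$$ Suppose that the iterated limit $$d=\lim_{\epsilon\to0^+}\ \lim_{l\to0^+}\frac{\log\mu(C_{\epsilon,l})}{\log l}$$ exists in $[0,\infty]$ (the inner limit existing for all sufficiently small $\epsilon>0$; conventions $\log 0=-\infty$, $\log\infty=\infty$). Then for $\mu$-almost every $x\in M$ $$\lim_{l\to0^+}\frac{\log\tau(x,B_l)}{-\log l}=d .$$ -/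

import Mathlib

open Set Filter Topology MeasureTheory
open scoped Manifold ContDiff ENNReal NNReal

noncomputable section

/-- The distance of the manifold `M` is locally bi-Lipschitz equivalent, in charts, to the norm
distance of the model space (every Riemannian distance has this property). -/
def IsLipschitzManifoldDist (E : Type*) [NormedAddCommGroup E] [NormedSpace ℝ E]
    (M : Type*) [MetricSpace M] [ChartedSpace E M] : Prop :=
  ∀ p : M, ∃ U ∈ 𝓝 p, ∃ L : ℝ, 0 < L ∧ ∀ x ∈ U, ∀ y ∈ U,
    dist (extChartAt 𝓘(ℝ, E) p x) (extChartAt 𝓘(ℝ, E) p y) ≤ L * dist x y ∧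
    dist x y ≤ L * dist (extChartAt 𝓘(ℝ, E) p x) (extChartAt 𝓘(ℝ, E) p y)

/-- A `C¹` flow: the map `(t, x) ↦ Φ^t(x)` is jointly `C¹`. -/
def IsC1Flow (E : Type*) [NormedAddCommGroup E] [NormedSpace ℝ E]
    {M : Type*} [TopologicalSpace M] [ChartedSpace E M] (Φ : Flow ℝ M) : Prop :=
  ContMDiff (𝓘(ℝ, ℝ).prod 𝓘(ℝ, E)) 𝓘(ℝ, E) 1 (fun q : ℝ × M => Φ q.1 q.2)

/-- The infinitesimal generator of the flow: the velocity at time `0` of the orbit of `x`. -/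
def flowGenerator (E : Type*) [NormedAddCommGroup E] [NormedSpace ℝ E]
    {M : Type*} [TopologicalSpace M] [ChartedSpace E M] (Φ : Flow ℝ M) (x : M) :
    TangentSpace 𝓘(ℝ, E) x :=
  mfderiv 𝓘(ℝ, ℝ) 𝓘(ℝ, E) (fun t : ℝ => Φ t x) 0 (1 : ℝ)

/-- The submanifold `ι : N → M` is transverse to the flow: at each of its points `p` the generator
is nonzero and `T_p M` is the direct sum of the tangent space of the submanifold and the line
spanned by the generator. -/
def IsTransverseToFlow (E : Type*) [NormedAddCommGroup E] [NormedSpace ℝ E]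
    (E' : Type*) [NormedAddCommGroup E'] [NormedSpace ℝ E']
    {M : Type*} [TopologicalSpace M] [ChartedSpace E M]
    {N : Type*} [TopologicalSpace N] [ChartedSpace E' N] (Φ : Flow ℝ M) (ι : N → M) : Prop :=
  ∀ y : N, flowGenerator E Φ (ι y) ≠ 0 ∧
    IsCompl (LinearMap.range (mfderiv 𝓘(ℝ, E') 𝓘(ℝ, E) ι y).toLinearMap)
      (Submodule.span ℝ {flowGenerator E Φ (ι y)})

/-- Bounded Lipschitz functions, i.e. those of finite Lipschitz norm. -/
def IsBoundedLipschitz {M : Type*} [MetricSpace M] (f : M → ℝ) : Prop :=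
  (∃ A : ℝ, ∀ x, |f x| ≤ A) ∧ ∃ K : ℝ≥0, LipschitzWith K f

/-- The Lipschitz norm `sup |f| + Lip f` of a bounded Lipschitz function. -/
def lipNorm {M : Type*} [MetricSpace M] (f : M → ℝ) : ℝ :=
  (⨆ x, |f x|) + sInf {K : ℝ | 0 ≤ K ∧ ∀ x y, |f x - f y| ≤ K * dist x y}

/-- Superpolynomial decay of correlations with respect to Lipschitz observables. -/
def HasSuperpolynomialDecay {M : Type*} [MetricSpace M] [MeasurableSpace M]
    (Φ : Flow ℝ M) (μ : Measure M) : Prop :=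
  ∃ (C : ℝ) (α : ℝ → ℝ),
    (∀ γ : ℝ, 0 < γ → Tendsto (fun t : ℝ => t ^ γ * α t) atTop (𝓝 0)) ∧
    ∀ f g : M → ℝ, IsBoundedLipschitz f → IsBoundedLipschitz g → ∀ t : ℝ, 0 ≤ t →
      |∫ x, g (Φ t x) * f x ∂μ - (∫ x, g x ∂μ) * ∫ x, f x ∂μ|
        ≤ C * lipNorm g * lipNorm f * α t

/-- The hitting time `inf {t > 0 : Φ^t(x) ∈ A}`, equal to `∞` if the orbit never hits `A`. -/
def hittingTime {M : Type*} [TopologicalSpace M] (Φ : Flow ℝ M) (x : M) (A : Set M) : ℝ≥0∞ :=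
  ⨅ (t : ℝ) (_ : 0 < t ∧ Φ t x ∈ A), ENNReal.ofReal t

/-- The target `B_l = {x ∈ V : f(x) < l}`. -/
def target {M : Type*} (V : Set M) (f : M → ℝ) (l : ℝ) : Set M :=
  {x | x ∈ V ∧ f x < l}

/-- The set `C_{ε,l}` of points which the flow brings into `B_l` at some time in `[0, ε)`. -/
def flowCylinder {M : Type*} [TopologicalSpace M] (Φ : Flow ℝ M) (V : Set M) (f : M → ℝ)
    (ε l : ℝ) : Set M :=
  {x | ∃ t : ℝ, 0 ≤ t ∧ t < ε ∧ Φ t x ∈ target V f l}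

end

/-! Lower bound on the hitting time (`ae_eventually_rpow_neg_le_hittingTime`): an orbit hitting
`B_l` before time `T` lies in `C_{ε,l}` at one of about `T/ε` multiples of `ε`, so by invariance
this has probability at most `(T/ε + 1) μ(C_{ε,l})`. For `T` a power of `1/l` of exponent below `d`
this is a positive power of `l`; Borel–Cantelli along `l = 2⁻ʲ` and monotonicity in `l` conclude,
without mixing.

Upper bound (`ae_eventually_hittingTime_le_rpow_neg`): take a Lipschitz bump equal to 1 on a shifted
cylinder over `B_l` and supported in its `c l`-neighbourhood. Its Lipschitz norm is of order `1/l`,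
so superpolynomial decay makes its values at times spaced by `l^(-δ)` nearly uncorrelated.
Chebyshev's inequality (`measureReal_forall_eq_zero_le`) then shows that slightly more than
`1/μ(C_{ε,l})` samples all miss the bump only with probability `O(l^δ)`, and Borel–Cantelli applies
again.

Geometry enters in `exists_thickening_subset_flowCylinder`: a point of the support must itself flow
into `B_{2l}`. Transversality and the inverse function theorem give Lipschitz flow boxes, uniform
over the compact closure of some `B_l`. -/

/-! ### Logarithmic quotients and powers of `l` -/

/-- With `a` written as the quotient belonging to `l ^ a`, comparisons of quotients reduce to
monotonicity of `ENNReal.log` and of division, so the values 0 and ∞ need no separate case. -/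
theorem coe_eq_log_rpow_div_log {l : ℝ} (hl : 0 < l) (hl1 : l < 1) (a : ℝ) :
    (a : EReal) = ENNReal.log (ENNReal.ofReal (l ^ a)) / ((Real.log l : ℝ) : EReal) := by
  have h : Real.log l < 0 := Real.log_neg hl hl1
  rw [ENNReal.log_ofReal_of_pos (Real.rpow_pos_of_pos hl a), Real.log_rpow hl, ← EReal.coe_div]
  rw [mul_div_cancel_right₀ _ h.ne]

theorem coe_eq_log_rpow_neg_div_neg_log {l : ℝ} (hl : 0 < l) (hl1 : l < 1) (a : ℝ) :
    (a : EReal) = ENNReal.log (ENNReal.ofReal (l ^ (-a))) / ((-Real.log l : ℝ) : EReal) := by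
  have h : Real.log l < 0 := Real.log_neg hl hl1
  rw [ENNReal.log_ofReal_of_pos (Real.rpow_pos_of_pos hl _), Real.log_rpow hl, ← EReal.coe_div]
  rw [neg_mul, neg_div_neg_eq, mul_div_cancel_right₀ _ h.ne]

theorem le_rpow_of_lt_log_div_log {l : ℝ} (hl : 0 < l) (hl1 : l < 1) {a : ℝ} {x : ℝ≥0∞}
    (h : (a : EReal) < ENNReal.log x / ((Real.log l : ℝ) : EReal)) :
    x ≤ ENNReal.ofReal (l ^ a) := by
  by_contra! hx
  refine h.not_ge ?_
  rw [coe_eq_log_rpow_div_log hl hl1 a]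
  exact EReal.div_le_div_right_of_nonpos
    (EReal.coe_nonpos.2 (Real.log_nonpos hl.le hl1.le)) (ENNReal.log_le_log hx.le)

theorem rpow_le_of_log_div_log_lt {l : ℝ} (hl : 0 < l) (hl1 : l < 1) {a : ℝ} {x : ℝ≥0∞}
    (h : ENNReal.log x / ((Real.log l : ℝ) : EReal) < a) :
    ENNReal.ofReal (l ^ a) ≤ x := by
  by_contra! hx
  refine h.not_ge ?_
  rw [coe_eq_log_rpow_div_log hl hl1 a]
  exact EReal.div_le_div_right_of_nonpos
    (EReal.coe_nonpos.2 (Real.log_nonpos hl.le hl1.le)) (ENNReal.log_le_log hx.le)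

theorem le_log_div_neg_log_of_rpow_le {l : ℝ} (hl : 0 < l) (hl1 : l < 1) {a : ℝ} {x : ℝ≥0∞}
    (h : ENNReal.ofReal (l ^ (-a)) ≤ x) :
    (a : EReal) ≤ ENNReal.log x / ((-Real.log l : ℝ) : EReal) := by
  rw [coe_eq_log_rpow_neg_div_neg_log hl hl1 a]
  exact EReal.div_le_div_right_of_nonneg
    (EReal.coe_nonneg.2 (neg_nonneg.2 (Real.log_nonpos hl.le hl1.le))) (ENNReal.log_le_log h)

theorem log_div_neg_log_le_of_le_rpow {l : ℝ} (hl : 0 < l) (hl1 : l < 1) {a : ℝ} {x : ℝ≥0∞}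
    (h : x ≤ ENNReal.ofReal (l ^ (-a))) :
    ENNReal.log x / ((-Real.log l : ℝ) : EReal) ≤ a := by
  rw [coe_eq_log_rpow_neg_div_neg_log hl hl1 a]
  exact EReal.div_le_div_right_of_nonneg
    (EReal.coe_nonneg.2 (neg_nonneg.2 (Real.log_nonpos hl.le hl1.le))) (ENNReal.log_le_log h)

/-- Constants are negligible compared with powers of `l` as `l → 0+`. -/
theorem eventually_mul_rpow_le_rpow (K : ℝ) {a b : ℝ} (hab : a < b) :
    ∀ᶠ l : ℝ in 𝓝[>] 0, K * l ^ b ≤ l ^ a := by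
  have h : Tendsto (fun l : ℝ => K * l ^ (b - a)) (𝓝[>] 0) (𝓝 (K * 0)) := by
    refine Tendsto.const_mul _ ?_
    have := (Real.continuousAt_rpow_const 0 (b - a) (Or.inr (by linarith))).tendsto
    rw [Real.zero_rpow (by linarith)] at this
    exact this.mono_left nhdsWithin_le_nhds
  rw [mul_zero] at h
  filter_upwards [h.eventually_lt_const one_pos, self_mem_nhdsWithin] with l h1 (hl : 0 < l)
  have hp := Real.rpow_pos_of_pos hl a
  have : l ^ b = l ^ (b - a) * l ^ a := by rw [← Real.rpow_add hl]; congr 1; ring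
  rw [this, ← mul_assoc]
  nlinarith

theorem tendsto_half_pow_nhdsGT_zero :
    Tendsto (fun j : ℕ => ((1 / 2 : ℝ)) ^ j) atTop (𝓝[>] 0) :=
  tendsto_nhdsWithin_iff.2 ⟨tendsto_pow_atTop_nhds_zero_of_lt_one (by norm_num) (by norm_num),
    Eventually.of_forall fun j => mem_Ioi.2 (by positivity)⟩

/-- Every small `l` is caught between two consecutive powers of `1 / 2`. -/
theorem eventually_exists_half_pow {P : ℕ → Prop} (hP : ∀ᶠ j in atTop, P j) :
    ∀ᶠ l : ℝ in 𝓝[>] 0, ∃ j : ℕ, P j ∧ P (j + 1) ∧ (1 / 2 : ℝ) ^ (j + 1) < l ∧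
      l ≤ (1 / 2 : ℝ) ^ j := by
  obtain ⟨J, hJ⟩ := eventually_atTop.1 hP
  have : Ioo (0 : ℝ) ((1 / 2) ^ J) ∈ 𝓝[>] (0 : ℝ) := Ioo_mem_nhdsGT (by positivity)
  filter_upwards [this] with l hl
  obtain ⟨j, hj1, hj2⟩ := exists_nat_pow_near_of_lt_one hl.1
    (hl.2.le.trans (pow_le_one₀ (by norm_num) (by norm_num))) (y := (1 / 2 : ℝ))
    (by norm_num) (by norm_num)
  have hJj : J ≤ j := by
    by_contra! h
    have : (1 / 2 : ℝ) ^ J ≤ (1 / 2) ^ (j + 1) :=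
      pow_le_pow_of_le_one (by norm_num) (by norm_num) h
    linarith [hl.2]
  exact ⟨j, hJ j hJj, hJ _ (by omega), hj1, hj2⟩

/-! ### Borel–Cantelli along dyadic scales -/

section BorelCantelli

variable {M : Type*} [MeasurableSpace M] {μ : Measure M}

/-- Borel–Cantelli along the scales `2⁻ʲ`. -/
theorem ae_eventually_half_pow_notMem {S : ℝ → Set M} {K δ : ℝ} (hδ : 0 < δ)
    (h : ∀ᶠ l : ℝ in 𝓝[>] 0, μ (S l) ≤ ENNReal.ofReal (K * l ^ δ)) :
    ∀ᵐ x ∂μ, ∀ᶠ j : ℕ in atTop, x ∉ S ((1 / 2) ^ j) := by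
  obtain ⟨J, hJ⟩ := eventually_atTop.1 (tendsto_half_pow_nhdsGT_zero.eventually h)
  have hsum : ∑' j, μ (S ((1 / 2) ^ (j + J))) ≠ ⊤ := by
    refine ne_top_of_le_ne_top ?_ (ENNReal.tsum_le_tsum fun j => hJ (j + J) (by omega))
    have hr : ((1 / 2 : ℝ) ^ δ) < 1 := Real.rpow_lt_one (by norm_num) (by norm_num) hδ
    have hs : Summable fun j : ℕ => K * ((1 / 2 : ℝ) ^ (j + J)) ^ δ := by
      refine Summable.mul_left _ ?_
      have : ∀ j : ℕ, ((1 / 2 : ℝ) ^ (j + J)) ^ δ = ((1 / 2 : ℝ) ^ δ) ^ (j + J) := fun j => by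
        rw [← Real.rpow_natCast, ← Real.rpow_mul (by norm_num), mul_comm,
          Real.rpow_mul (by norm_num), Real.rpow_natCast]
      simp only [this]
      exact (summable_nat_add_iff J).2 (summable_geometric_of_lt_one (by positivity) hr)
    exact hs.tsum_ofReal_ne_top
  filter_upwards [ae_eventually_notMem hsum] with x hx
  obtain ⟨J', hJ'⟩ := eventually_atTop.1 hx
  refine eventually_atTop.2 ⟨J' + J, fun j hj => ?_⟩
  have := hJ' (j - J) (by omega)
  rwa [Nat.sub_add_cancel (by omega)] at this

/-- For `2^(-(j+1)) < l / c ≤ 2^(-j)`, monotonicity transfers the bound from the lower dyadic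
endpoint; the constant lost is absorbed by `b < a`. The factor `c` allows for an enlarged target. -/
theorem ae_eventually_le_rpow_neg {τ : M → ℝ → ℝ≥0∞} (hτ : ∀ x, Antitone (τ x)) {K δ a b c : ℝ}
    (hδ : 0 < δ) (hb : 0 ≤ b) (hab : b < a) (hc : 0 < c)
    (h : ∀ᶠ l : ℝ in 𝓝[>] 0,
      μ {x | ENNReal.ofReal (l ^ (-b)) < τ x (c * l)} ≤ ENNReal.ofReal (K * l ^ δ)) :
    ∀ᵐ x ∂μ, ∀ᶠ l : ℝ in 𝓝[>] 0, τ x l ≤ ENNReal.ofReal (l ^ (-a)) := by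
  filter_upwards [ae_eventually_half_pow_notMem hδ h] with x hx
  have hc' : Tendsto (fun l : ℝ => l / c) (𝓝[>] 0) (𝓝[>] 0) := by
    refine tendsto_nhdsWithin_iff.2 ⟨?_, ?_⟩
    · have : Tendsto (fun l : ℝ => l / c) (𝓝 0) (𝓝 (0 / c)) := tendsto_id.div_const c
      rw [zero_div] at this
      exact this.mono_left nhdsWithin_le_nhds
    · filter_upwards [self_mem_nhdsWithin] with l (hl : 0 < l)
      exact div_pos hl hc
  filter_upwards [hc'.eventually (eventually_exists_half_pow hx), self_mem_nhdsWithin,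
    eventually_mul_rpow_le_rpow (((1 / 2) / c) ^ (-b)) (neg_lt_neg hab)] with l hl (hl0 : 0 < l) hK
  obtain ⟨j, -, hj, hj1, hj2⟩ := hl
  have hj' : τ x (c * (1 / 2) ^ (j + 1)) ≤ ENNReal.ofReal (((1 / 2) ^ (j + 1)) ^ (-b)) :=
    not_lt.1 hj
  have h1 : c * (1 / 2) ^ (j + 1) ≤ l := by
    rw [lt_div_iff₀ hc] at hj1; linarith
  refine (hτ x h1).trans (hj'.trans (ENNReal.ofReal_le_ofReal (le_trans ?_ hK)))
  rw [← Real.mul_rpow (by positivity) hl0.le]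
  refine Real.rpow_le_rpow_of_nonpos (by positivity) ?_ (by linarith)
  rw [pow_succ]
  calc 1 / 2 / c * l = (l / c) * (1 / 2) := by ring
    _ ≤ _ := by gcongr

theorem ae_eventually_rpow_neg_le {τ : M → ℝ → ℝ≥0∞} (hτ : ∀ x, Antitone (τ x)) {K δ a b : ℝ}
    (hδ : 0 < δ) (hb : 0 ≤ b) (hab : a < b)
    (h : ∀ᶠ l : ℝ in 𝓝[>] 0,
      μ {x | τ x l < ENNReal.ofReal (l ^ (-b))} ≤ ENNReal.ofReal (K * l ^ δ)) :
    ∀ᵐ x ∂μ, ∀ᶠ l : ℝ in 𝓝[>] 0, ENNReal.ofReal (l ^ (-a)) ≤ τ x l := by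
  filter_upwards [ae_eventually_half_pow_notMem hδ h] with x hx
  filter_upwards [eventually_exists_half_pow hx, self_mem_nhdsWithin,
    eventually_mul_rpow_le_rpow (2 ^ b) (neg_lt_neg hab)] with l hl (hl0 : 0 < l) hK
  obtain ⟨j, hj, -, hj1, hj2⟩ := hl
  have hj' : ENNReal.ofReal (((1 / 2) ^ j) ^ (-b)) ≤ τ x ((1 / 2) ^ j) := not_lt.1 hj
  refine le_trans (ENNReal.ofReal_le_ofReal ?_) (hj'.trans (hτ x hj2))
  have h1 : (2 * l) ^ (-b) ≤ ((1 / 2 : ℝ) ^ j) ^ (-b) := by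
    refine Real.rpow_le_rpow_of_nonpos (by positivity) ?_ (by linarith)
    rw [pow_succ] at hj1; linarith
  refine le_trans ?_ h1
  rw [Real.mul_rpow (by norm_num) hl0.le, Real.rpow_neg (x := 2) (by norm_num)]
  rw [inv_mul_eq_div, le_div_iff₀ (by positivity), mul_comm]
  exact hK
end BorelCantelli

/-! ### Second moment estimate -/

section Chebyshev
variable {M : Type*} [MeasurableSpace M] {μ : Measure M} [IsProbabilityMeasure μ]

/-- If the correlations of the observables `g 0, …, g (n - 1)` with common mean `m` are at most
`κ`, the set on which all of them vanish is small. -/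
theorem measureReal_forall_eq_zero_le {n : ℕ} {g : ℕ → M → ℝ} (hg : ∀ i, Measurable (g i))
    (hg0 : ∀ i x, 0 ≤ g i x) (hg1 : ∀ i x, g i x ≤ 1) {m κ : ℝ} (hm : ∀ i, ∫ x, g i x ∂μ = m)
    (hκ : ∀ i j, i < j → ∫ x, g j x * g i x ∂μ - m * m ≤ κ) (hκ0 : 0 ≤ κ) :
    (n * m) ^ 2 * μ.real {x | ∀ i < n, g i x = 0} ≤ n * m + n ^ 2 * κ := by
  have hint : ∀ i, Integrable (g i) μ := fun i =>
    Integrable.of_bound (hg i).aestronglyMeasurable 1 (ae_of_all _ fun x => by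
      rw [Real.norm_of_nonneg (hg0 i x)]; exact hg1 i x)
  have hint2 : ∀ i j, Integrable (fun x => g i x * g j x) μ := fun i j =>
    Integrable.of_bound ((hg i).mul (hg j)).aestronglyMeasurable 1 (ae_of_all _ fun x => by
      rw [Real.norm_of_nonneg (mul_nonneg (hg0 i x) (hg0 j x))]
      exact mul_le_one₀ (hg1 i x) (hg0 j x) (hg1 j x))
  have hm0 : 0 ≤ m := hm 0 ▸ integral_nonneg (hg0 0)
  have hint3 : ∀ i j, Integrable (fun x => g i x * g j x - m * g i x) μ := fun i j =>
    (hint2 i j).sub ((hint i).const_mul m)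
  have hint4 : ∀ j, Integrable (fun x => m * g j x - m * m) μ := fun j =>
    ((hint j).const_mul m).sub (integrable_const _)
  have hexp : ∀ i j, (fun x => (g i x - m) * (g j x - m)) =
      fun x => (g i x * g j x - m * g i x) - (m * g j x - m * m) := fun i j => by ext x; ring
  have hcov : ∀ i j, ∫ x, (g i x - m) * (g j x - m) ∂μ = ∫ x, g i x * g j x ∂μ - m * m := by
    intro i j
    rw [hexp, integral_sub (hint3 i j) (hint4 j),
      integral_sub (hint2 i j) ((hint i).const_mul m),
      integral_sub ((hint j).const_mul m) (integrable_const _),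
      integral_const_mul, integral_const_mul, hm, hm]
    simp
  have hintc : ∀ i j, Integrable (fun x => (g i x - m) * (g j x - m)) μ := fun i j => by
    rw [hexp]
    exact (hint3 i j).sub (hint4 j)
  -- Off the diagonal this is the correlation bound; on it, `0 ≤ g ≤ 1` gives `g² ≤ g`, so the
  -- variance is at most `m`.
  have hbound : ∀ i j, ∫ x, (g i x - m) * (g j x - m) ∂μ ≤ κ + if i = j then m else 0 := by
    intro i j
    rw [hcov]
    rcases lt_trichotomy i j with h | h | h
    · have := hκ i j h
      simp only [mul_comm (g j _)] at this
      simpa [h.ne] using this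
    · subst h
      have h1 : ∫ x, g i x * g i x ∂μ ≤ ∫ x, g i x ∂μ :=
        integral_mono (hint2 i i) (hint i) fun x => mul_le_of_le_one_left (hg0 i x) (hg1 i x)
      rw [hm] at h1
      simp only [if_true]
      nlinarith
    · simpa [h.ne'] using hκ j i h
  set S : M → ℝ := fun x => ∑ i ∈ Finset.range n, (g i x - m) with hS
  have hS2 : (fun x => S x ^ 2) = fun x => ∑ i ∈ Finset.range n, ∑ j ∈ Finset.range n,
      (g i x - m) * (g j x - m) := by
    ext x; rw [hS, sq, Finset.sum_mul_sum]
  have hSint : Integrable (fun x => S x ^ 2) μ := by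
    rw [hS2]
    exact integrable_finsetSum _ fun i _ => integrable_finsetSum _ fun j _ => hintc i j
  have hSle : ∫ x, S x ^ 2 ∂μ ≤ n * m + n ^ 2 * κ := by
    rw [hS2, integral_finsetSum _ fun i _ => integrable_finsetSum _ fun j _ => hintc i j]
    calc ∑ i ∈ Finset.range n, ∫ x, ∑ j ∈ Finset.range n, (g i x - m) * (g j x - m) ∂μ
        = ∑ i ∈ Finset.range n, ∑ j ∈ Finset.range n, ∫ x, (g i x - m) * (g j x - m) ∂μ :=
          Finset.sum_congr rfl fun i _ => integral_finsetSum _ fun j _ => hintc i j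
      _ ≤ ∑ i ∈ Finset.range n, ∑ j ∈ Finset.range n, (κ + if i = j then m else 0) :=
          Finset.sum_le_sum fun i _ => Finset.sum_le_sum fun j _ => hbound i j
      _ = n * m + n ^ 2 * κ := by
          simp only [Finset.sum_add_distrib, Finset.sum_const, Finset.card_range, nsmul_eq_mul]
          have : ∀ i ∈ Finset.range n, (∑ j ∈ Finset.range n, if i = j then m else 0) = m := by
            intro i hi
            rw [Finset.sum_ite_eq, if_pos hi]
          rw [Finset.sum_congr rfl this]
          simp
          ring
  set Z : Set M := {x | ∀ i < n, g i x = 0}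
  have hcheb := mul_meas_ge_le_integral_of_nonneg (ae_of_all μ fun x => sq_nonneg (S x)) hSint
    ((n * m) ^ 2)
  -- If all observables vanish, the centred sum sits at distance exactly `n * m` from its mean 0.
  have hsub : Z ⊆ {x | (n * m) ^ 2 ≤ S x ^ 2} := by
    intro x hx
    have : S x = -(n * m) := by
      simp only [hS]
      rw [Finset.sum_congr rfl fun i hi => by rw [hx i (Finset.mem_range.1 hi)]]
      simp
    simp [this]
  calc (n * m) ^ 2 * μ.real Z ≤ (n * m) ^ 2 * μ.real {x | (n * m) ^ 2 ≤ S x ^ 2} :=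
        mul_le_mul_of_nonneg_left (measureReal_mono hsub) (sq_nonneg _)
    _ ≤ _ := hcheb.trans hSle

end Chebyshev

/-! ### Lipschitz norms and correlations along the flow -/

section LipNorm
variable {M : Type*} [MetricSpace M]

theorem lipNorm_nonneg (h : M → ℝ) : 0 ≤ lipNorm h :=
  add_nonneg (Real.iSup_nonneg fun _ => abs_nonneg _) (Real.sInf_nonneg fun _ hK => hK.1)

theorem lipNorm_le {h : M → ℝ} {A K : ℝ} (hA : 0 ≤ A) (hhA : ∀ x, |h x| ≤ A) (hK : 0 ≤ K)
    (hhK : ∀ x y, |h x - h y| ≤ K * dist x y) : lipNorm h ≤ A + K :=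
  add_le_add (Real.iSup_le hhA hA) (csInf_le ⟨0, fun _ hK => hK.1⟩ ⟨hK, hhK⟩)

end LipNorm

section Flow
variable {M : Type*} [MetricSpace M] [MeasurableSpace M] [BorelSpace M] {μ : Measure M}
  [IsProbabilityMeasure μ] {Φ : Flow ℝ M}

/-- By invariance all samples have the same mean, and the correlation of samples `i < j` depends
only on the lag `(j - i) * s ≥ s`. Sampling starts at time `s` rather than 0 because hitting times
only count positive times. -/
theorem measureReal_forall_flow_eq_zero_le (hμ : ∀ t : ℝ, MeasurePreserving (Φ t) μ μ)
    {h : M → ℝ} (hh : Continuous h) (h0 : ∀ x, 0 ≤ h x) (h1 : ∀ x, h x ≤ 1) {s κ : ℝ}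
    (hs : 0 ≤ s) (hκ0 : 0 ≤ κ)
    (hκ : ∀ t, s ≤ t → |∫ x, h (Φ t x) * h x ∂μ - (∫ x, h x ∂μ) * ∫ x, h x ∂μ| ≤ κ) (n : ℕ) :
    (n * ∫ x, h x ∂μ) ^ 2 * μ.real {x | ∀ i < n, h (Φ ((i + 1 : ℕ) * s) x) = 0} ≤
      n * (∫ x, h x ∂μ) + n ^ 2 * κ := by
  have hc : ∀ t, Continuous (Φ t) := fun t => Φ.continuous continuous_const continuous_id
  have hinv : ∀ (t : ℝ) (u : M → ℝ), Continuous u → ∫ x, u (Φ t x) ∂μ = ∫ x, u x ∂μ := by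
    intro t u hu
    have := integral_map (μ := μ) (hc t).measurable.aemeasurable
      (hu.measurable.aestronglyMeasurable (μ := μ.map (Φ t)))
    rwa [(hμ t).map_eq, eq_comm] at this
  refine measureReal_forall_eq_zero_le (g := fun i x => h (Φ ((i + 1 : ℕ) * s) x))
    (fun i => (hh.comp (hc _)).measurable) (fun i x => h0 _) (fun i x => h1 _)
    (fun i => hinv _ h hh) (fun i j hij => ?_) hκ0
  have hij' : (i : ℝ) + 1 ≤ j := by exact_mod_cast hij
  have key := (le_abs_self _).trans (hκ ((j - i : ℝ) * s) (by nlinarith))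
  rw [← hinv ((i + 1 : ℕ) * s) (fun x => h (Φ ((j - i : ℝ) * s) x) * h x)
    ((hh.comp (hc _)).mul hh)] at key
  simp only [← Φ.map_add] at key
  have ht : ((j : ℝ) - i) * s + (i + 1 : ℕ) * s = (j + 1 : ℕ) * s := by push_cast; ring
  rwa [ht] at key

omit [BorelSpace M] [IsProbabilityMeasure μ] in
/-- The correlation bound at times `t ≥ s`, for observables with values in `[0, 1]` and Lipschitz
constant `K`. -/
theorem HasSuperpolynomialDecay.exists_bound (hdecay : HasSuperpolynomialDecay Φ μ) {γ : ℝ}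
    (hγ : 0 < γ) : ∃ C T : ℝ, 0 ≤ C ∧ ∀ (h : M → ℝ) (K : ℝ≥0), LipschitzWith K h →
      (∀ x, 0 ≤ h x) → (∀ x, h x ≤ 1) → ∀ s t : ℝ, 0 < s → T ≤ s → s ≤ t →
      |∫ x, h (Φ t x) * h x ∂μ - (∫ x, h x ∂μ) * ∫ x, h x ∂μ| ≤
        C * (1 + K) ^ 2 * s ^ (-γ) := by
  obtain ⟨C, α, hα, hC⟩ := hdecay
  have h1 := (hα γ hγ).abs
  rw [abs_zero] at h1
  obtain ⟨T, hT⟩ := eventually_atTop.1 (h1.eventually_lt_const one_pos)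
  refine ⟨|C|, T, abs_nonneg _, fun h K hK h0 h1 s t hs hTs hst => ?_⟩
  have habs : ∀ x, |h x| ≤ 1 := fun x => by rw [abs_of_nonneg (h0 x)]; exact h1 x
  have hlip : IsBoundedLipschitz h := ⟨⟨1, habs⟩, K, hK⟩
  have hnorm : lipNorm h ≤ 1 + K := lipNorm_le zero_le_one habs K.2 fun x y => by
    have := hK.dist_le_mul x y
    rwa [Real.dist_eq] at this
  refine (hC h h hlip hlip t (by linarith)).trans ?_
  have ht : 0 < t := hs.trans_le hst
  -- Neither `C` nor `α` is assumed nonnegative, hence the absolute values.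
  have hαt : |α t| ≤ s ^ (-γ) := by
    have h2 := (hT t (hTs.trans hst)).le
    rw [abs_mul, abs_of_pos (Real.rpow_pos_of_pos ht _)] at h2
    have h3 : |α t| ≤ t ^ (-γ) := by
      rw [Real.rpow_neg ht.le, ← one_div, le_div_iff₀ (Real.rpow_pos_of_pos ht _), mul_comm]
      exact h2
    exact h3.trans (Real.rpow_le_rpow_of_nonpos hs hst (by linarith))
  have hn := lipNorm_nonneg h
  calc C * lipNorm h * lipNorm h * α t ≤ |C * lipNorm h * lipNorm h * α t| := le_abs_self _
    _ = |C| * (lipNorm h) ^ 2 * |α t| := by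
      rw [abs_mul, abs_mul, abs_mul, abs_of_nonneg hn]; ring
    _ ≤ _ := by gcongr

end Flow

/-! ### Transversality in charts -/

section Geometry

variable {E : Type*} [NormedAddCommGroup E] [NormedSpace ℝ E]
  {M : Type*} [TopologicalSpace M] [ChartedSpace E M]
  {E' : Type*} [NormedAddCommGroup E'] [NormedSpace ℝ E']
  {N : Type*} [TopologicalSpace N] [ChartedSpace E' N] {ι : N → M} {Φ : Flow ℝ M}

/-- The differential of an immersion is injective. -/
theorem Manifold.IsImmersionAt.mfderiv_injective {y : N}
    (h : Manifold.IsImmersionAt 𝓘(ℝ, E') 𝓘(ℝ, E) 1 ι y) :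
    Function.Injective (mfderiv 𝓘(ℝ, E') 𝓘(ℝ, E) ι y) := by
  -- A local left inverse of `ι`: in the charts of the immersion `ι` is `u ↦ (u, 0)`, which is
  -- undone by projecting. The chain rule for `R ∘ ι = id` near `y` then gives injectivity.
  set R : M → N := fun x =>
    (h.domChart.extend 𝓘(ℝ, E')).symm (h.equiv.symm (h.codChart.extend 𝓘(ℝ, E) x)).1 with hR
  have hwritten : ∀ z ∈ h.domChart.source,
      h.codChart.extend 𝓘(ℝ, E) (ι z) = h.equiv (h.domChart.extend 𝓘(ℝ, E') z, 0) := by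
    intro z hz
    have hz' : z ∈ (h.domChart.extend 𝓘(ℝ, E')).source := by simpa using hz
    have := h.writtenInCharts ((h.domChart.extend 𝓘(ℝ, E')).map_source hz')
    simpa only [Function.comp_apply, (h.domChart.extend 𝓘(ℝ, E')).left_inv hz'] using this
  have hRι : ∀ z ∈ h.domChart.source, R (ι z) = z := by
    intro z hz
    have hz' : z ∈ (h.domChart.extend 𝓘(ℝ, E')).source := by simpa using hz
    simp only [hR, hwritten z hz, ContinuousLinearEquiv.symm_apply_apply]
    exact (h.domChart.extend 𝓘(ℝ, E')).left_inv hz'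
  have hy := h.mem_domChart_source
  have hRd : MDifferentiableAt 𝓘(ℝ, E) 𝓘(ℝ, E') R (ι y) := by
    have h1 : MDifferentiableAt 𝓘(ℝ, E) 𝓘(ℝ, E) (h.codChart.extend 𝓘(ℝ, E)) (ι y) :=
      (h.codChart.contMDiffAt_extend h.codChart_mem_maximalAtlas
        h.mem_codChart_source).mdifferentiableAt one_ne_zero
    have h2 : MDifferentiableAt 𝓘(ℝ, E) 𝓘(ℝ, E') (fun v : E => (h.equiv.symm v).1)
        (h.codChart.extend 𝓘(ℝ, E) (ι y)) :=
      (differentiableAt_fst.comp _ h.equiv.symm.differentiableAt).mdifferentiableAt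
    have h3 : MDifferentiableAt 𝓘(ℝ, E') 𝓘(ℝ, E') (h.domChart.extend 𝓘(ℝ, E')).symm
        (h.equiv.symm (h.codChart.extend 𝓘(ℝ, E) (ι y))).1 := by
      refine ((contMDiffOn_extend_symm h.domChart_mem_maximalAtlas).contMDiffAt
        ?_).mdifferentiableAt one_ne_zero
      rw [hwritten y hy]
      simp only [ContinuousLinearEquiv.symm_apply_apply]
      have : 𝓘(ℝ, E') '' h.domChart.target = h.domChart.target := by simp
      rw [this]
      exact h.domChart.open_target.mem_nhds (h.domChart.map_source hy)
    exact h3.comp (ι y) (h2.comp (ι y) h1)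
  have hιd : MDifferentiableAt 𝓘(ℝ, E') 𝓘(ℝ, E) ι y := h.contMDiffAt.mdifferentiableAt one_ne_zero
  have hcomp := mfderiv_comp y hRd hιd
  have hid : mfderiv 𝓘(ℝ, E') 𝓘(ℝ, E') (R ∘ ι) y = mfderiv 𝓘(ℝ, E') 𝓘(ℝ, E') id y := by
    refine Filter.EventuallyEq.mfderiv_eq ?_
    filter_upwards [h.domChart.open_source.mem_nhds hy] with z hz using hRι z hz
  intro v w hvw
  have key : ∀ u, mfderiv 𝓘(ℝ, E') 𝓘(ℝ, E') (R ∘ ι) y u = u := fun u => by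
    rw [hid, mfderiv_id]; rfl
  rw [← key v, ← key w, hcomp]
  exact congrArg (mfderiv 𝓘(ℝ, E) 𝓘(ℝ, E') R (ι y)) hvw

theorem IsC1Flow.contMDiff_orbit (hΦ : IsC1Flow E Φ) (x : M) :
    ContMDiff 𝓘(ℝ, ℝ) 𝓘(ℝ, E) 1 (fun t : ℝ => Φ t x) :=
  ContMDiff.comp hΦ (contMDiff_id.prodMk contMDiff_const)

/-- The transversality condition, read in charts. -/
theorem exists_hasFDerivAt_chart (hΦ : IsC1Flow E Φ)
    (hι : Manifold.IsSmoothEmbedding 𝓘(ℝ, E') 𝓘(ℝ, E) 1 ι)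
    (hV : IsTransverseToFlow E E' Φ ι) (y : N) :
    ∃ (T : E' →L[ℝ] E) (X : E),
      HasFDerivAt (fun u => extChartAt 𝓘(ℝ, E) (ι y) (ι ((extChartAt 𝓘(ℝ, E') y).symm u))) T
        (extChartAt 𝓘(ℝ, E') y y) ∧
      HasDerivAt (fun t : ℝ => extChartAt 𝓘(ℝ, E) (ι y) (Φ t (ι y))) X 0 ∧
      Function.Injective T ∧ X ≠ 0 ∧ IsCompl T.toLinearMap.range (Submodule.span ℝ {X}) := by
  have hιy := hι.isImmersion.isImmersionAt y
  refine ⟨mfderiv 𝓘(ℝ, E') 𝓘(ℝ, E) ι y, flowGenerator E Φ (ι y), ?_, ?_,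
    hιy.mfderiv_injective, (hV y).1, (hV y).2⟩
  · have h := (hιy.contMDiffAt.mdifferentiableAt one_ne_zero).hasMFDerivAt.2
    rw [ModelWithCorners.range_eq_univ] at h
    exact hasFDerivWithinAt_univ.1 h
  · have h := (((hΦ.contMDiff_orbit (ι y)).contMDiffAt (x := 0)).mdifferentiableAt
        one_ne_zero).hasMFDerivAt.2
    rw [ModelWithCorners.range_eq_univ] at h
    have h' : HasFDerivAt (writtenInExtChartAt 𝓘(ℝ, ℝ) 𝓘(ℝ, E) 0 fun t : ℝ => Φ t (ι y))
      (show ℝ →L[ℝ] E from mfderiv 𝓘(ℝ, ℝ) 𝓘(ℝ, E) (fun t : ℝ => Φ t (ι y)) 0) 0 :=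
      hasFDerivWithinAt_univ.1 h
    have h'' := h'.hasDerivAt
    have hw : writtenInExtChartAt 𝓘(ℝ, ℝ) 𝓘(ℝ, E) 0 (fun t : ℝ => Φ t (ι y)) =
        fun t : ℝ => extChartAt 𝓘(ℝ, E) (ι y) (Φ t (ι y)) := by
      ext t
      simp [writtenInExtChartAt, chartAt_self_eq]
    rw [hw] at h''
    exact h''

variable [FiniteDimensional ℝ E] [FiniteDimensional ℝ E']
  [IsManifold 𝓘(ℝ, E') 1 N]

/-- In charts, `(y, t) ↦ Φ^{-t}(ι y)` has an invertible strict derivative at `t = 0`. -/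
theorem exists_hasStrictFDerivAt_flow_chart (hΦ : IsC1Flow E Φ)
    (hι : Manifold.IsSmoothEmbedding 𝓘(ℝ, E') 𝓘(ℝ, E) 1 ι)
    (hV : IsTransverseToFlow E E' Φ ι) (y : N) :
    ∃ A : (E' × ℝ) ≃L[ℝ] E, HasStrictFDerivAt
      (fun q : E' × ℝ => extChartAt 𝓘(ℝ, E) (ι y)
        (Φ (-q.2) (ι ((extChartAt 𝓘(ℝ, E') y).symm q.1))))
      (A : (E' × ℝ) →L[ℝ] E) (extChartAt 𝓘(ℝ, E') y y, 0) := by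
  set a : E' × ℝ := (extChartAt 𝓘(ℝ, E') y y, 0) with ha
  set G : E' × ℝ → E := fun q : E' × ℝ => extChartAt 𝓘(ℝ, E) (ι y)
        (Φ (-q.2) (ι ((extChartAt 𝓘(ℝ, E') y).symm q.1))) with hG
  have hιc : ContMDiff 𝓘(ℝ, E') 𝓘(ℝ, E) 1 ι := hι.isImmersion.contMDiff
  have hsymm : ContMDiffAt 𝓘(ℝ, E') 𝓘(ℝ, E') 1 (extChartAt 𝓘(ℝ, E') y).symm
      (extChartAt 𝓘(ℝ, E') y y) :=
    (contMDiffOn_extChartAt_symm y).contMDiffAt (extChartAt_target_mem_nhds y)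
  have hιs : ContMDiffAt 𝓘(ℝ, E' × ℝ) 𝓘(ℝ, E) 1
      (fun q : E' × ℝ => ι ((extChartAt 𝓘(ℝ, E') y).symm q.1)) a :=
    hιc.contMDiffAt.comp a (ContMDiffAt.comp a hsymm contDiff_fst.contMDiff.contMDiffAt)
  have hneg : ContMDiffAt 𝓘(ℝ, E' × ℝ) 𝓘(ℝ, ℝ) 1 (fun q : E' × ℝ => -q.2) a :=
    contDiff_snd.neg.contMDiff.contMDiffAt
  have hΨ : ContMDiffAt 𝓘(ℝ, E' × ℝ) 𝓘(ℝ, E) 1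
      (fun q : E' × ℝ => Φ (-q.2) (ι ((extChartAt 𝓘(ℝ, E') y).symm q.1))) a :=
    ContMDiffAt.comp a (ContMDiff.contMDiffAt hΦ) (hneg.prodMk hιs)
  have hΨa : Φ (-a.2) (ι ((extChartAt 𝓘(ℝ, E') y).symm a.1)) = ι y := by
    simp [ha]
  have hGc : ContDiffAt ℝ 1 G a := by
    rw [← contMDiffAt_iff_contDiffAt]
    refine ContMDiffAt.comp a ?_ hΨ
    rw [hΨa]
    exact contMDiffAt_extChartAt
  have hGs := hGc.hasStrictFDerivAt one_ne_zero
  set D := fderiv ℝ G a with hD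
  have hGd : HasFDerivAt G D a := hGs.hasFDerivAt
  obtain ⟨T, X, hT, hX, hTinj, hX0, hcompl⟩ := exists_hasFDerivAt_chart hΦ hι hV y
  have hD1 : D.comp (ContinuousLinearMap.inl ℝ E' ℝ) = T := by
    have h1 : HasFDerivAt (G ∘ fun u : E' => (u, (0 : ℝ)))
        (D.comp (ContinuousLinearMap.inl ℝ E' ℝ)) (extChartAt 𝓘(ℝ, E') y y) :=
      HasFDerivAt.comp _ hGd (hasFDerivAt_prodMk_left _ _)
    refine h1.unique (hT.congr_of_eventuallyEq (Eventually.of_forall fun u => ?_))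
    simp [hG]
  have hD2 : D (0, 1) = -X := by
    have h1 : HasFDerivAt (G ∘ fun t : ℝ => (extChartAt 𝓘(ℝ, E') y y, t))
        (D.comp (ContinuousLinearMap.inr ℝ E' ℝ)) 0 :=
      HasFDerivAt.comp _ hGd (hasFDerivAt_prodMk_right _ _)
    have h3 := hX.scomp_of_eq (0 : ℝ) (hasDerivAt_neg (0 : ℝ)) (by simp)
    have h4 : (G ∘ fun t : ℝ => (extChartAt 𝓘(ℝ, E') y y, t)) =
        (fun t : ℝ => extChartAt 𝓘(ℝ, E) (ι y) (Φ t (ι y))) ∘ (fun t : ℝ => -t) := by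
      ext t
      simp [hG]
    rw [h4] at h1
    simpa using h1.hasDerivAt.unique h3
  have hDeq : ∀ (v : E') (t : ℝ), D (v, t) = T v - t • X := by
    intro v t
    have : ((v, t) : E' × ℝ) = (v, 0) + t • (0, 1) := by simp
    rw [this, map_add, map_smul, hD2, smul_neg, ← sub_eq_add_neg, ← hD1]
    rfl
  -- A kernel vector has `T v = t • X` in both summands of the direct sum, hence zero; surjectivity
  -- is the spanning half of the same decomposition.
  have hker : D.toLinearMap.ker = ⊥ := by
    refine LinearMap.ker_eq_bot'.2 ?_
    rintro ⟨v, t⟩ hvt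
    have h0 : T v = t • X := sub_eq_zero.1 ((hDeq v t).symm.trans hvt)
    have h1 : T v = 0 :=
      (Submodule.disjoint_def.1 hcompl.disjoint) _ ⟨v, rfl⟩
        (Submodule.mem_span_singleton.2 ⟨t, h0.symm⟩)
    have hv : v = 0 := hTinj (h1.trans (map_zero _).symm)
    have ht : t = 0 := by
      rw [h1] at h0
      exact (smul_eq_zero.1 h0.symm).resolve_right hX0
    rw [hv, ht]; rfl
  have hrange : D.toLinearMap.range = ⊤ := by
    refine LinearMap.range_eq_top.2 fun w => ?_
    obtain ⟨u, ⟨v, rfl⟩, x, hx, hux⟩ :=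
      Submodule.mem_sup.1 (hcompl.sup_eq_top ▸ Submodule.mem_top : w ∈ _)
    obtain ⟨t, rfl⟩ := Submodule.mem_span_singleton.1 hx
    refine ⟨(v, -t), (hDeq v (-t)).trans ?_⟩
    rw [neg_smul, sub_neg_eq_add]
    exact hux
  have : CompleteSpace E := FiniteDimensional.complete ℝ E
  have : CompleteSpace E' := FiniteDimensional.complete ℝ E'
  exact ⟨ContinuousLinearEquiv.ofBijective D hker hrange, hGs⟩

end Geometry

/-! ### Lipschitz flow boxes -/

section FlowBox

variable {E : Type*} [NormedAddCommGroup E] [NormedSpace ℝ E] [FiniteDimensional ℝ E]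
  {M : Type*} [MetricSpace M] [ChartedSpace E M]
  {E' : Type*} [NormedAddCommGroup E'] [NormedSpace ℝ E'] [FiniteDimensional ℝ E']
  {N : Type*} [TopologicalSpace N] [ChartedSpace E' N] [IsManifold 𝓘(ℝ, E') 1 N]
  {ι : N → M} {Φ : Flow ℝ M}

/-- Lipschitz flow-box coordinates near a point of a transverse submanifold: `s z` is the time after
which the point `z` reaches the submanifold and `π z` is the point where it does so. -/
theorem exists_flow_coordinates (hdist : IsLipschitzManifoldDist E M) (hΦ : IsC1Flow E Φ)
    (hι : Manifold.IsSmoothEmbedding 𝓘(ℝ, E') 𝓘(ℝ, E) 1 ι)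
    (hV : IsTransverseToFlow E E' Φ ι) (y : N) :
    ∃ (s : M → ℝ) (π : M → M) (L r : ℝ), 0 < L ∧ 0 < r ∧ ∃ W ∈ 𝓝 (ι y),
      (∀ z ∈ W, π z ∈ range ι ∧ Φ (s z) z = π z) ∧
      (∀ z ∈ W, ∀ w ∈ W, |s z - s w| ≤ L * dist z w ∧ dist (π z) (π w) ≤ L * dist z w) ∧
      ∀ p ∈ W, p ∈ range ι → ∀ t : ℝ, |t| < r → s (Φ (-t) p) = t ∧ π (Φ (-t) p) = p := by
  have : CompleteSpace E' := FiniteDimensional.complete ℝ E'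
  obtain ⟨A, hGs⟩ := exists_hasStrictFDerivAt_flow_chart hΦ hι hV y
  set e := extChartAt 𝓘(ℝ, E) (ι y) with he
  set e' := extChartAt 𝓘(ℝ, E') y with he'
  set a : E' × ℝ := (e' y, 0) with ha
  set Ψ : E' × ℝ → M := fun q => Φ (-q.2) (ι (e'.symm q.1)) with hΨ
  set G : E' × ℝ → E := fun q => e (Φ (-q.2) (ι (e'.symm q.1))) with hG
  set g : E → E' × ℝ := hGs.localInverse G A a with hg
  -- `P` is a local inverse of `Ψ`: its components are the chart coordinate of the arrival point on
  -- `N` and the arrival time.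
  set P : M → E' × ℝ := fun z => g (e z) with hP
  have hιc : Continuous ι := hι.isEmbedding.continuous
  have hΨa : Ψ a = ι y := by simp [hΨ, ha, he']
  have hGa : G a = e (ι y) := by rw [← hΨa]
  have hec : ContinuousAt e (ι y) := continuousAt_extChartAt (ι y)
  have hesrc : e.source ∈ 𝓝 (ι y) := extChartAt_source_mem_nhds (ι y)
  have he'src : e'.source ∈ 𝓝 y := extChartAt_source_mem_nhds y
  have hga : Tendsto g (𝓝 (e (ι y))) (𝓝 a) := by
    have h1 := hGs.localInverse_continuousAt.tendsto
    rw [hGs.localInverse_apply_image] at h1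
    exact hGa ▸ h1
  have hPc : Tendsto P (𝓝 (ι y)) (𝓝 a) := hga.comp hec
  have hsymm : Tendsto (fun q : E' × ℝ => ι (e'.symm q.1)) (𝓝 a) (𝓝 (ι y)) := by
    have h1 : ContinuousAt e'.symm (e' y) := continuousAt_extChartAt_symm y
    have h2 : Tendsto e'.symm (𝓝 (e' y)) (𝓝 y) := by
      have := h1.tendsto
      rwa [he', extChartAt_to_inv] at this
    exact (hιc.tendsto y).comp (h2.comp (continuous_fst.tendsto a))
  have hΨc : Tendsto Ψ (𝓝 a) (𝓝 (ι y)) := by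
    have h1 : Continuous (fun q : ℝ × M => Φ q.1 q.2) := Φ.continuous continuous_fst continuous_snd
    have h2 := (h1.tendsto (-a.2, ι y)).comp
      (((continuous_snd.neg).tendsto a).prodMk_nhds hsymm)
    simpa [ha, hΨ, Function.comp_def] using h2
  have hrec : ∀ᶠ z in 𝓝 (ι y), Ψ (P z) = z := by
    have h1 : ∀ᶠ w in 𝓝 (e (ι y)), G (g w) = w := hGa ▸ hGs.eventually_right_inverse
    filter_upwards [hesrc, hec.eventually h1, (hΨc.comp hPc).eventually hesrc] with z hz1 hz2 hz3
    exact e.injOn hz3 hz1 hz2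
  obtain ⟨U, hU, L₀, hL₀, hUL⟩ := hdist (ι y)
  obtain ⟨K₁, S₁, hS₁, hK₁⟩ := hGs.to_localInverse.exists_lipschitzOnWith
  rw [hGa] at hS₁
  obtain ⟨K₂, S₂, hS₂, hK₂⟩ := hGs.exists_lipschitzOnWith
  have hP0 : Tendsto (fun z => ((P z).1, (0 : ℝ))) (𝓝 (ι y)) (𝓝 a) :=
    ((continuous_fst.tendsto a).comp hPc).prodMk_nhds tendsto_const_nhds
  have hPlip : ∀ z ∈ U ∩ e ⁻¹' S₁, ∀ w ∈ U ∩ e ⁻¹' S₁,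
      dist (P z) (P w) ≤ K₁ * L₀ * dist z w := by
    rintro z ⟨hz, hz'⟩ w ⟨hw, hw'⟩
    calc dist (P z) (P w) ≤ K₁ * dist (e z) (e w) := hK₁.dist_le_mul _ hz' _ hw'
      _ ≤ K₁ * (L₀ * dist z w) := by gcongr; exact (hUL z hz w hw).1
      _ = _ := by ring
  set π : M → M := fun z => ι (e'.symm (P z).1) with hπ
  set T : Set M := {z | π z ∈ U ∧ ((P z).1, (0 : ℝ)) ∈ S₂} with hT
  have hTn : T ∈ 𝓝 (ι y) := by
    filter_upwards [(hsymm.comp hPc).eventually hU, hP0.eventually hS₂] with z h1 h2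
    exact ⟨h1, h2⟩
  have hπlip : ∀ z ∈ T, ∀ w ∈ T, dist (π z) (π w) ≤ L₀ * K₂ * dist (P z) (P w) := by
    rintro z ⟨hz, hz'⟩ w ⟨hw, hw'⟩
    have hGπ : ∀ v, G ((P v).1, 0) = e (π v) := fun v => by simp [hG, hπ]
    calc dist (π z) (π w) ≤ L₀ * dist (e (π z)) (e (π w)) := (hUL _ hz _ hw).2
      _ = L₀ * dist (G ((P z).1, 0)) (G ((P w).1, 0)) := by rw [hGπ, hGπ]
      _ ≤ L₀ * (K₂ * dist ((P z).1, (0 : ℝ)) ((P w).1, 0)) := by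
        gcongr; exact hK₂.dist_le_mul _ hz' _ hw'
      _ ≤ L₀ * (K₂ * dist (P z) (P w)) := by
        gcongr
        rw [Prod.dist_eq, Prod.dist_eq, dist_self]
        exact max_le_max le_rfl dist_nonneg
      _ = _ := by ring
  have hleft : ∀ᶠ q : N × ℝ in 𝓝 (y, 0), P (Φ (-q.2) (ι q.1)) = (e' q.1, q.2) := by
    have h1 : Tendsto (fun q : N × ℝ => (e' q.1, q.2)) (𝓝 (y, 0)) (𝓝 a) :=
      (((continuousAt_extChartAt y).tendsto.comp (continuous_fst.tendsto (y, (0 : ℝ)))).prodMk_nhds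
        (continuous_snd.tendsto (y, (0 : ℝ))))
    filter_upwards [h1.eventually hGs.eventually_left_inverse,
      (continuous_fst.tendsto (y, (0 : ℝ))).eventually he'src] with q hq1 hq2
    have : e'.symm (e' q.1) = q.1 := e'.left_inv hq2
    have hGq : G (e' q.1, q.2) = e (Φ (-q.2) (ι q.1)) := by simp only [hG, this]
    rw [hGq] at hq1
    exact hq1
  rw [nhds_prod_eq] at hleft
  obtain ⟨p₁, hp₁, p₂, hp₂, hpp⟩ := eventually_prod_iff.1 hleft
  obtain ⟨r, hr, hr'⟩ := Metric.eventually_nhds_iff.1 hp₂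
  -- The embedding property matters here: a point of `range ι` close to `ι y` in `M` comes from a
  -- point close to `y` in `N`.
  rw [hι.isEmbedding.nhds_eq_comap] at hp₁ he'src
  obtain ⟨W₁, hW₁, hW₁'⟩ := mem_comap.1 hp₁
  obtain ⟨W₂, hW₂, hW₂'⟩ := mem_comap.1 he'src
  -- A single positive constant dominating `K₁ * L₀` (for the time) and `K₁ * L₀ * (L₀ * K₂)` (for
  -- the projection).
  refine ⟨fun z => (P z).2, π, (K₁ * L₀ + 1) * (L₀ * K₂ + 1), r, by positivity, hr,
    ((U ∩ e ⁻¹' S₁) ∩ T) ∩ ({z | Ψ (P z) = z} ∩ (W₁ ∩ W₂)),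
    inter_mem (inter_mem (inter_mem hU (hec hS₁)) hTn) (inter_mem hrec (inter_mem hW₁ hW₂)),
    ?_, ?_, ?_⟩
  · rintro z ⟨-, hz, -⟩
    refine ⟨mem_range_self _, ?_⟩
    have hz' : Φ (-(P z).2) (π z) = z := hz
    calc Φ (P z).2 z = Φ (P z).2 (Φ (-(P z).2) (π z)) := by rw [hz']
      _ = π z := by rw [← Φ.map_add, add_neg_cancel, Φ.map_zero_apply]
  · rintro z ⟨⟨hz1, hz2⟩, -⟩ w ⟨⟨hw1, hw2⟩, -⟩
    have h1 := hPlip z hz1 w hw1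
    have h2 := hπlip z hz2 w hw2
    have h3 : |(P z).2 - (P w).2| ≤ dist (P z) (P w) := by
      rw [← Real.dist_eq, Prod.dist_eq]; exact le_max_right _ _
    have hd := dist_nonneg (x := z) (y := w)
    have hc1 : 0 ≤ K₁ * L₀ := by positivity
    have hc2 : 0 ≤ L₀ * K₂ := by positivity
    constructor
    · calc _ ≤ K₁ * L₀ * dist z w := h3.trans h1
        _ ≤ _ := mul_le_mul_of_nonneg_right (by nlinarith [mul_nonneg hc1 hc2]) hd
    · calc _ ≤ L₀ * K₂ * (K₁ * L₀ * dist z w) := h2.trans (by gcongr)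
        _ = (K₁ * L₀) * (L₀ * K₂) * dist z w := by ring
        _ ≤ _ := mul_le_mul_of_nonneg_right (by nlinarith [mul_nonneg hc1 hc2]) hd
  · rintro _ ⟨-, -, hw1, hw2⟩ ⟨y', rfl⟩ t ht
    have h1 : P (Φ (-t) (ι y')) = (e' y', t) := hpp (hW₁' hw1) (hr' (by simpa using ht))
    refine ⟨congrArg Prod.snd h1, ?_⟩
    have h2 : e'.symm (e' y') = y' := e'.left_inv (hW₂' hw2)
    simp only [hπ, h1, h2]

/-- The witness is `t' = s z`. The flow coordinates of `Φ (-t) p` are exactly `t` and `p`, so both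
estimates are the Lipschitz bounds for `s` and `π`. -/
theorem exists_local_flow_box (hdist : IsLipschitzManifoldDist E M) (hΦ : IsC1Flow E Φ)
    (hι : Manifold.IsSmoothEmbedding 𝓘(ℝ, E') 𝓘(ℝ, E) 1 ι)
    (hV : IsTransverseToFlow E E' Φ ι) {p₀ : M} (hp₀ : p₀ ∈ range ι) :
    ∃ W ∈ 𝓝 p₀, ∃ δ L : ℝ, 0 < δ ∧ 0 < L ∧ ∀ p ∈ W, p ∈ range ι → ∀ t : ℝ, |t| < δ →
      ∀ z, dist z (Φ (-t) p) < δ → ∃ t' : ℝ, Φ t' z ∈ range ι ∧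
        |t' - t| ≤ L * dist z (Φ (-t) p) ∧ dist (Φ t' z) p ≤ L * dist z (Φ (-t) p) := by
  obtain ⟨y, rfl⟩ := hp₀
  obtain ⟨s, π, L, r, hL, hr, W, hW, h1, h2, h3⟩ := exists_flow_coordinates hdist hΦ hι hV y
  obtain ⟨ρ, hρ, hρW⟩ := Metric.mem_nhds_iff.1 hW
  have hcont : Tendsto (fun q : M × ℝ => Φ (-q.2) q.1) (𝓝 (ι y, 0)) (𝓝 (ι y)) := by
    have : Continuous fun q : M × ℝ => Φ (-q.2) q.1 := Φ.continuous continuous_snd.neg continuous_fst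
    simpa using this.tendsto (ι y, 0)
  have hball := hcont.eventually (Metric.ball_mem_nhds (ι y) (half_pos hρ))
  rw [nhds_prod_eq] at hball
  obtain ⟨p₁, hp₁, p₂, hp₂, hpp⟩ := eventually_prod_iff.1 hball
  obtain ⟨r', hr', hr''⟩ := Metric.eventually_nhds_iff.1 hp₂
  refine ⟨W ∩ {p | p₁ p}, inter_mem hW hp₁, min (min r r') (ρ / 2), L,
    lt_min (lt_min hr hr') (half_pos hρ), hL, ?_⟩
  rintro p ⟨hpW, hp1⟩ hpV t ht z hz
  have ht1 : |t| < r := ht.trans_le ((min_le_left _ _).trans (min_le_left _ _))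
  have ht2 : |t| < r' := ht.trans_le ((min_le_left _ _).trans (min_le_right _ _))
  have hb : dist (Φ (-t) p) (ι y) < ρ / 2 := hpp hp1 (hr'' (by simpa using ht2))
  have hz' : dist z (Φ (-t) p) < ρ / 2 := hz.trans_le (min_le_right _ _)
  have hwW : Φ (-t) p ∈ W := hρW (Metric.mem_ball.2 (by linarith))
  have hzW : z ∈ W := hρW (Metric.mem_ball.2 (by
    have := dist_triangle z (Φ (-t) p) (ι y); linarith))
  obtain ⟨hz1, hz2⟩ := h1 z hzW
  obtain ⟨hs, hπ⟩ := h2 z hzW _ hwW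
  obtain ⟨hs', hπ'⟩ := h3 p hpW hpV t ht1
  rw [hs'] at hs
  rw [hπ'] at hπ
  exact ⟨s z, hz2 ▸ hz1, hs, hz2.symm ▸ hπ⟩

/-- Uniform flow boxes along a compact subset of a transverse submanifold. -/
theorem exists_flow_box (hdist : IsLipschitzManifoldDist E M) (hΦ : IsC1Flow E Φ)
    (hι : Manifold.IsSmoothEmbedding 𝓘(ℝ, E') 𝓘(ℝ, E) 1 ι)
    (hV : IsTransverseToFlow E E' Φ ι) {K : Set M} (hK : IsCompact K) (hKV : K ⊆ range ι) :
    ∃ δ L : ℝ, 0 < δ ∧ 0 < L ∧ ∀ p ∈ K, ∀ t : ℝ, |t| < δ →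
      ∀ z, dist z (Φ (-t) p) < δ → ∃ t' : ℝ, Φ t' z ∈ range ι ∧
        |t' - t| ≤ L * dist z (Φ (-t) p) ∧ dist (Φ t' z) p ≤ L * dist z (Φ (-t) p) := by
  -- The compactness induction runs over sets that may leave `range ι`, so membership is required of
  -- the points instead.
  suffices h : ∃ δ L : ℝ, 0 < δ ∧ 0 < L ∧ ∀ p ∈ K, p ∈ range ι → ∀ t : ℝ, |t| < δ →
      ∀ z, dist z (Φ (-t) p) < δ → ∃ t' : ℝ, Φ t' z ∈ range ι ∧
        |t' - t| ≤ L * dist z (Φ (-t) p) ∧ dist (Φ t' z) p ≤ L * dist z (Φ (-t) p) by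
    obtain ⟨δ, L, hδ, hL, h⟩ := h
    exact ⟨δ, L, hδ, hL, fun p hp => h p hp (hKV hp)⟩
  refine hK.induction_on (p := fun S : Set M => ∃ δ L : ℝ, 0 < δ ∧ 0 < L ∧ ∀ p ∈ S, p ∈ range ι →
      ∀ t : ℝ, |t| < δ → ∀ z, dist z (Φ (-t) p) < δ → ∃ t' : ℝ, Φ t' z ∈ range ι ∧
        |t' - t| ≤ L * dist z (Φ (-t) p) ∧ dist (Φ t' z) p ≤ L * dist z (Φ (-t) p)) ?_ ?_ ?_ ?_
  · exact ⟨1, 1, one_pos, one_pos, fun p hp => hp.elim⟩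
  · rintro S T hST ⟨δ, L, hδ, hL, h⟩
    exact ⟨δ, L, hδ, hL, fun p hp => h p (hST hp)⟩
  · rintro S T ⟨δ, L, hδ, hL, h⟩ ⟨δ', L', hδ', hL', h'⟩
    refine ⟨min δ δ', max L L', lt_min hδ hδ', lt_max_of_lt_left hL, ?_⟩
    rintro p (hp | hp) hpV t ht z hz
    · obtain ⟨t', h1, h2, h3⟩ := h p hp hpV t (ht.trans_le (min_le_left _ _)) z
        (hz.trans_le (min_le_left _ _))
      have hLL := mul_le_mul_of_nonneg_right (le_max_left L L') (dist_nonneg (x := z)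
        (y := Φ (-t) p))
      exact ⟨t', h1, h2.trans hLL, h3.trans hLL⟩
    · obtain ⟨t', h1, h2, h3⟩ := h' p hp hpV t (ht.trans_le (min_le_right _ _)) z
        (hz.trans_le (min_le_right _ _))
      have hLL := mul_le_mul_of_nonneg_right (le_max_right L L') (dist_nonneg (x := z)
        (y := Φ (-t) p))
      exact ⟨t', h1, h2.trans hLL, h3.trans hLL⟩
  · intro p hp
    obtain ⟨W, hW, h⟩ := exists_local_flow_box hdist hΦ hι hV (hKV hp)
    exact ⟨W, mem_nhdsWithin_of_mem_nhds hW, h⟩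

/-- An orbit through a transverse submanifold leaves it for a positive time. -/
theorem eventually_flow_notMem (hdist : IsLipschitzManifoldDist E M) (hΦ : IsC1Flow E Φ)
    (hι : Manifold.IsSmoothEmbedding 𝓘(ℝ, E') 𝓘(ℝ, E) 1 ι)
    (hV : IsTransverseToFlow E E' Φ ι) {x : M} (hx : x ∈ range ι) :
    ∃ r : ℝ, 0 < r ∧ ∀ t : ℝ, 0 < t → t < r → Φ t x ∉ range ι := by
  obtain ⟨y, rfl⟩ := hx
  obtain ⟨s, π, L, r, hL, hr, W, hW, -, -, h3⟩ := exists_flow_coordinates hdist hΦ hι hV y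
  have hcont : Tendsto (fun t : ℝ => Φ t (ι y)) (𝓝 0) (𝓝 (ι y)) := by
    have : Continuous fun t : ℝ => Φ t (ι y) := Φ.continuous continuous_id continuous_const
    simpa using this.tendsto 0
  obtain ⟨r', hr', hr''⟩ := Metric.eventually_nhds_iff.1 (hcont.eventually hW)
  refine ⟨min r r', lt_min hr hr', fun t ht0 ht hmem => ?_⟩
  have habs : |t| < min r r' := by rwa [abs_of_pos ht0]
  have hW' : Φ t (ι y) ∈ W := hr'' (by simpa using habs.trans_le (min_le_right _ _))
  -- A return at time `t` would give `s (ι y)` two values: `t`, flowing back from the return point,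
  -- and 0.
  have h4 := (h3 _ hW' hmem t (habs.trans_le (min_le_left _ _))).1
  have h5 := (h3 _ (mem_of_mem_nhds hW) (mem_range_self y) 0 (by simpa using hr)).1
  rw [← Φ.map_add, neg_add_cancel, Φ.map_zero_apply] at h4
  rw [neg_zero, Φ.map_zero_apply] at h5
  linarith

end FlowBox

/-! ### Elementary properties of hitting times -/

section HittingTime

variable {M : Type*}

theorem target_mono (V : Set M) (f : M → ℝ) : Monotone (target V f) :=
  fun _ _ hl _ hx => ⟨hx.1, hx.2.trans_le hl⟩

variable [TopologicalSpace M] {Φ : Flow ℝ M} {V : Set M} {f : M → ℝ}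

theorem hittingTime_le {x : M} {A : Set M} {t : ℝ} (ht : 0 < t) (hx : Φ t x ∈ A) :
    hittingTime Φ x A ≤ ENNReal.ofReal t :=
  iInf₂_le t ⟨ht, hx⟩

theorem hittingTime_anti (x : M) : Antitone fun l => hittingTime Φ x (target V f l) :=
  fun _ _ hl => le_iInf₂ fun _ ht => hittingTime_le ht.1 (target_mono V f hl ht.2)

theorem exists_of_hittingTime_lt {x : M} {A : Set M} {T : ℝ≥0∞} (h : hittingTime Φ x A < T) :
    ∃ t : ℝ, 0 < t ∧ Φ t x ∈ A ∧ ENNReal.ofReal t < T := by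
  obtain ⟨t, ht⟩ := iInf_lt_iff.1 h
  obtain ⟨⟨h1, h2⟩, h3⟩ := iInf_lt_iff.1 ht
  exact ⟨t, h1, h2, h3⟩

theorem hittingTime_le_of_mem_flowCylinder {x : M} {ε l u : ℝ} (hu : 0 < u)
    (hx : Φ u x ∈ flowCylinder Φ V f ε l) :
    hittingTime Φ x (target V f l) ≤ ENNReal.ofReal (u + ε) := by
  obtain ⟨t, ht0, htε, ht⟩ := hx
  rw [← Φ.map_add] at ht
  exact (hittingTime_le (by linarith) ht).trans (ENNReal.ofReal_le_ofReal (by linarith))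

end HittingTime

/-! ### Thickened cylinders and positivity of hitting times -/

section Cylinder

variable {E : Type*} [NormedAddCommGroup E] [NormedSpace ℝ E] [FiniteDimensional ℝ E]
  {M : Type*} [MetricSpace M] [ChartedSpace E M]
  {E' : Type*} [NormedAddCommGroup E'] [NormedSpace ℝ E'] [FiniteDimensional ℝ E']
  {N : Type*} [TopologicalSpace N] [ChartedSpace E' N] [IsManifold 𝓘(ℝ, E') 1 N]
  {ι : N → M} {Φ : Flow ℝ M} {f : M → ℝ}

/-- A neighbourhood of size proportional to `l` of the shifted cylinder of height `ε / 2` over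
`B_l` lies in the cylinder of height `ε` over `B_{2l}`. -/
theorem exists_thickening_subset_flowCylinder (hdist : IsLipschitzManifoldDist E M)
    (hΦ : IsC1Flow E Φ) (hι : Manifold.IsSmoothEmbedding 𝓘(ℝ, E') 𝓘(ℝ, E) 1 ι)
    (hV : IsTransverseToFlow E E' Φ ι) (hf : ∃ K : ℝ≥0, LipschitzWith K f)
    (hcpt : ∃ l : ℝ, 0 < l ∧ IsCompact (closure (target (range ι) f l)) ∧
      closure (target (range ι) f l) ⊆ range ι) :
    ∃ ε₀ c : ℝ, 0 < ε₀ ∧ 0 < c ∧ ∀ ε, 0 < ε → ε < ε₀ → ∀ᶠ l : ℝ in 𝓝[>] 0,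
      Metric.thickening (c * l) (Φ (ε / 4) ⁻¹' flowCylinder Φ (range ι) f (ε / 2) l) ⊆
        flowCylinder Φ (range ι) f ε (2 * l) := by
  obtain ⟨K, hK⟩ := hf
  obtain ⟨l₀, hl₀, hc, hcV⟩ := hcpt
  obtain ⟨δ, L, hδ, hL, hbox⟩ := exists_flow_box hdist hΦ hι hV hc hcV
  have hK0 : (0 : ℝ) ≤ K := K.2
  have hc0 : 0 < 1 / (L * (K + 1)) := by positivity
  -- This `c` makes both the time error `L * dist z x` and the resulting change `K * L * dist z x`
  -- of `f` smaller than `l`; the latter accounts for `2 * l`.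
  refine ⟨δ, 1 / (L * (K + 1)), hδ, hc0, fun ε hε hεδ => ?_⟩
  have hl1 : 0 < min l₀ (min (δ / (1 / (L * (K + 1)))) (ε / 4)) :=
    lt_min hl₀ (lt_min (by positivity) (by positivity))
  filter_upwards [Ioo_mem_nhdsGT hl1] with l hl z hz
  obtain ⟨hl0, hl⟩ := hl
  obtain ⟨h1, h2, h3⟩ : l < l₀ ∧ l < δ / (1 / (L * (K + 1))) ∧ l < ε / 4 := by
    simpa only [lt_min_iff] using hl
  obtain ⟨x, ⟨u, hu0, hu1, hu⟩, hzx⟩ := Metric.mem_thickening_iff.1 hz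
  -- The point `x` reaches `p` at time `u + ε / 4` in `[ε/4, 3ε/4)`, so a time error below `l < ε /
  -- 4` keeps the arrival time of `z` inside `[0, ε)`.
  set p := Φ u (Φ (ε / 4) x) with hp
  have hxp : Φ (-(u + ε / 4)) p = x := by
    rw [hp, ← Φ.map_add, ← Φ.map_add]
    simp
  have hzδ : dist z x < δ := by
    rw [lt_div_iff₀ hc0] at h2; linarith
  have hut : |u + ε / 4| < δ := by rw [abs_of_nonneg (by linarith)]; linarith
  obtain ⟨t, htV, ht1, ht2⟩ := hbox p (subset_closure (target_mono _ _ h1.le hu)) (u + ε / 4) hut z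
    (by rwa [hxp])
  rw [hxp] at ht1 ht2
  have hLd : L * dist z x * (K + 1) < l := by
    have : 1 / (L * (K + 1)) * l = l / (L * (K + 1)) := by ring
    rw [this, lt_div_iff₀ (by positivity)] at hzx
    linarith
  have hLd0 : 0 ≤ L * dist z x := by positivity
  have hLd1 : L * dist z x < l := by nlinarith
  have hLdK : K * (L * dist z x) < l := by nlinarith
  obtain ⟨ht3, ht4⟩ := abs_le.1 ht1
  refine ⟨t, by linarith, by linarith, htV, ?_⟩
  have hfd : |f (Φ t z) - f p| ≤ K * dist (Φ t z) p := by
    rw [← Real.dist_eq]; exact hK.dist_le_mul _ _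
  have := mul_le_mul_of_nonneg_left ht2 hK0
  have hfp : f p < l := hu.2
  linarith [(abs_le.1 hfd).2]

/-- An orbit starting in `closure A` leaves the submanifold by transversality; one starting
elsewhere stays off the closed set for a while. This settles negative exponents in the lower bound.
-/
theorem hittingTime_pos (hdist : IsLipschitzManifoldDist E M)
    (hΦ : IsC1Flow E Φ) (hι : Manifold.IsSmoothEmbedding 𝓘(ℝ, E') 𝓘(ℝ, E) 1 ι)
    (hV : IsTransverseToFlow E E' Φ ι) {A : Set M}
    (hA : closure A ⊆ range ι) (x : M) : 0 < hittingTime Φ x A := by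
  suffices h : ∃ r : ℝ, 0 < r ∧ ∀ t : ℝ, 0 < t → t < r → Φ t x ∉ A by
    obtain ⟨r, hr, h⟩ := h
    refine (ENNReal.ofReal_pos.2 hr).trans_le (le_iInf₂ fun t ht => ENNReal.ofReal_le_ofReal ?_)
    by_contra! htr
    exact h t ht.1 htr ht.2
  by_cases hx : x ∈ closure A
  · obtain ⟨r, hr, h⟩ := eventually_flow_notMem hdist hΦ hι hV (hA hx)
    exact ⟨r, hr, fun t h0 h1 h2 => h t h0 h1 (hA (subset_closure h2))⟩
  · have hcont : Tendsto (fun t : ℝ => Φ t x) (𝓝 0) (𝓝 x) := by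
      have : Continuous fun t : ℝ => Φ t x := Φ.continuous continuous_id continuous_const
      simpa using this.tendsto 0
    obtain ⟨r, hr, h⟩ := Metric.eventually_nhds_iff.1
      (hcont.eventually (isClosed_closure.isOpen_compl.mem_nhds hx))
    exact ⟨r, hr, fun t h0 h1 h2 => h (by simpa [abs_of_pos h0] using h1) (subset_closure h2)⟩

end Cylinder

/-! ### Almost sure bounds for the hitting time -/

section Bounds

variable {M : Type*} [MetricSpace M] [MeasurableSpace M] [BorelSpace M] {μ : Measure M}
  [IsProbabilityMeasure μ] {Φ : Flow ℝ M} {V : Set M} {f : M → ℝ}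

-- Since `Φ t` is a homeomorphism, `S` may be arbitrary, and measurability of the cylinders never
-- has to be checked.
omit [IsProbabilityMeasure μ] in
theorem measure_flow_preimage (hμ : ∀ t : ℝ, MeasurePreserving (Φ t) μ μ) (t : ℝ) (S : Set M) :
    μ (Φ t ⁻¹' S) = μ S :=
  (hμ t).measure_preimage_emb (Φ.toHomeomorph t).measurableEmbedding S

-- If the target is hit at time `t < T`, then at time `⌊t / ε⌋ * ε` the orbit is in the cylinder;
-- there are at most `T / ε + 1` such times, all equally likely by invariance.
omit [IsProbabilityMeasure μ] in
theorem measure_hittingTime_lt_le (hμ : ∀ t : ℝ, MeasurePreserving (Φ t) μ μ) {ε l T : ℝ}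
    (hε : 0 < ε) (hT : 0 ≤ T) :
    μ {x | hittingTime Φ x (target V f l) < ENNReal.ofReal T} ≤
      ENNReal.ofReal (T / ε + 1) * μ (flowCylinder Φ V f ε l) := by
  have hsub : {x | hittingTime Φ x (target V f l) < ENNReal.ofReal T} ⊆
      ⋃ k ∈ Finset.range (⌊T / ε⌋₊ + 1), Φ (k * ε) ⁻¹' flowCylinder Φ V f ε l := by
    intro x hx
    obtain ⟨t, ht0, htA, htT⟩ := exists_of_hittingTime_lt hx
    have htT' : t < T := (ENNReal.ofReal_lt_ofReal_iff_of_nonneg ht0.le).1 htT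
    have h0 : 0 ≤ t / ε := by positivity
    have h1 := Nat.floor_le h0
    have h2 := Nat.lt_floor_add_one (t / ε)
    rw [le_div_iff₀ hε] at h1
    rw [div_lt_iff₀ hε] at h2
    refine mem_biUnion (x := ⌊t / ε⌋₊) (Finset.mem_coe.2 (Finset.mem_range.2
      (Nat.lt_succ_of_le (Nat.floor_le_floor (by gcongr))))) ⟨t - ⌊t / ε⌋₊ * ε, by linarith, by
        linarith, ?_⟩
    rwa [← Φ.map_add, sub_add_cancel]
  calc _ ≤ μ (⋃ k ∈ Finset.range (⌊T / ε⌋₊ + 1), Φ (k * ε) ⁻¹' flowCylinder Φ V f ε l) :=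
        measure_mono hsub
    _ ≤ ∑ k ∈ Finset.range (⌊T / ε⌋₊ + 1), μ (Φ (k * ε) ⁻¹' flowCylinder Φ V f ε l) :=
        measure_biUnion_finset_le _ _
    _ = (⌊T / ε⌋₊ + 1 : ℕ) * μ (flowCylinder Φ V f ε l) := by
        simp [measure_flow_preimage hμ]
    _ ≤ _ := by
        gcongr
        rw [← ENNReal.ofReal_natCast]
        refine ENNReal.ofReal_le_ofReal ?_
        push_cast
        linarith [Nat.floor_le (show 0 ≤ T / ε by positivity)]

omit [IsProbabilityMeasure μ] in
/-- The hitting time is not much smaller than the reciprocal of the measure of the cylinders. -/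
theorem ae_eventually_rpow_neg_le_hittingTime (hμ : ∀ t : ℝ, MeasurePreserving (Φ t) μ μ)
    {ε a b : ℝ} (hε : 0 < ε) (ha : 0 ≤ a) (hab : a < b)
    (h : ∀ᶠ l : ℝ in 𝓝[>] 0, μ (flowCylinder Φ V f ε l) ≤ ENNReal.ofReal (l ^ b)) :
    ∀ᵐ x ∂μ, ∀ᶠ l : ℝ in 𝓝[>] 0,
      ENNReal.ofReal (l ^ (-a)) ≤ hittingTime Φ x (target V f l) := by
  -- At the midpoint exponent, `T = l ^ (-(a+b)/2)` against measure `l ^ b` leaves `l ^ ((b-a)/2)`;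
  -- the rest of the gap serves the dyadic interpolation.
  refine ae_eventually_rpow_neg_le (τ := fun x l => hittingTime Φ x (target V f l))
    hittingTime_anti (K := 1 / ε + 1) (δ := (b - a) / 2) (b := (a + b) / 2) (by linarith)
    (by linarith) (by linarith) ?_
  filter_upwards [h, Ioo_mem_nhdsGT one_pos] with l hl ⟨hl0, hl1⟩
  have hT := Real.rpow_pos_of_pos hl0 (-((a + b) / 2))
  have hT1 : 1 ≤ l ^ (-((a + b) / 2)) :=
    Real.one_le_rpow_of_pos_of_le_one_of_nonpos hl0 hl1.le (by linarith)
  refine (measure_hittingTime_lt_le hμ hε hT.le).trans ?_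
  refine (mul_le_mul_right hl _).trans ?_
  rw [← ENNReal.ofReal_mul (by positivity)]
  refine ENNReal.ofReal_le_ofReal ?_
  have hlb := Real.rpow_pos_of_pos hl0 b
  calc (l ^ (-((a + b) / 2)) / ε + 1) * l ^ b
      ≤ (l ^ (-((a + b) / 2)) / ε + l ^ (-((a + b) / 2))) * l ^ b := by gcongr
    _ = (1 / ε + 1) * (l ^ (-((a + b) / 2)) * l ^ b) := by ring
    _ = (1 / ε + 1) * l ^ ((b - a) / 2) := by
      rw [← Real.rpow_add hl0]; congr 2; ring

/-- The set of points which avoid the support of an observable along many equally spaced times. -/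
theorem measureReal_forall_flow_eq_zero_le_add (hμ : ∀ t : ℝ, MeasurePreserving (Φ t) μ μ)
    {h : M → ℝ} (hh : Continuous h) (h0 : ∀ x, 0 ≤ h x) (h1 : ∀ x, h x ≤ 1) {s κ : ℝ}
    (hs : 0 ≤ s) (hκ0 : 0 ≤ κ)
    (hκ : ∀ t, s ≤ t → |∫ x, h (Φ t x) * h x ∂μ - (∫ x, h x ∂μ) * ∫ x, h x ∂μ| ≤ κ) {n : ℕ}
    {m ν : ℝ} (hm : 0 < m) (hhm : m ≤ ∫ x, h x ∂μ) (hν : 0 < ν) (hn : ν ≤ n) :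
    μ.real {x | ∀ i < n, h (Φ ((i + 1 : ℕ) * s) x) = 0} ≤ 1 / (ν * m) + κ / m ^ 2 := by
  have key := measureReal_forall_flow_eq_zero_le hμ hh h0 h1 hs hκ0 hκ n
  set I := ∫ x, h x ∂μ
  set Z := μ.real {x | ∀ i < n, h (Φ ((i + 1 : ℕ) * s) x) = 0}
  have hI : 0 < I := hm.trans_le hhm
  have hn' : (0 : ℝ) < n := hν.trans_le hn
  have h2 : Z ≤ 1 / (n * I) + κ / I ^ 2 := by
    have : 1 / (n * I) + κ / I ^ 2 = (n * I + n ^ 2 * κ) / (n * I) ^ 2 := by field_simp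
    rw [this, le_div_iff₀ (by positivity)]
    linarith
  exact h2.trans (by gcongr)

/-- The hitting time is not much larger than the reciprocal of the measure of the cylinders. -/
theorem ae_eventually_hittingTime_le_rpow_neg (hμ : ∀ t : ℝ, MeasurePreserving (Φ t) μ μ)
    (hdecay : HasSuperpolynomialDecay Φ μ) {ε c a b : ℝ} (hε : 0 < ε) (hc : 0 < c) (hb : 0 ≤ b)
    (hab : b < a)
    (hthick : ∀ᶠ l : ℝ in 𝓝[>] 0,
      Metric.thickening (c * l) (Φ (ε / 4) ⁻¹' flowCylinder Φ V f (ε / 2) l) ⊆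
        flowCylinder Φ V f ε (2 * l))
    (h : ∀ᶠ l : ℝ in 𝓝[>] 0, ENNReal.ofReal (l ^ b) ≤ μ (flowCylinder Φ V f (ε / 2) l)) :
    ∀ᵐ x ∂μ, ∀ᶠ l : ℝ in 𝓝[>] 0,
      hittingTime Φ x (target V f l) ≤ ENNReal.ofReal (l ^ (-a)) := by
  -- Exponent budget: `l^(-(b+δ))` samples at spacing `l^(-δ)` take time of order `l^(-(b+2δ))`; the
  -- third `δ` absorbs constants, the fourth the dyadic interpolation.
  obtain ⟨δ, hδ, rfl⟩ : ∃ δ : ℝ, 0 < δ ∧ a = b + 4 * δ := ⟨(a - b) / 4, by linarith, by ring⟩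
  -- Chosen so that `s ^ (-γ) = l ^ (2 + 2b + δ)`: this beats `l⁻²` from the squared Lipschitz norm
  -- and `l^(-2b)` from the squared mean, leaving `l ^ δ`.
  set γ : ℝ := (2 + 2 * b + δ) / δ with hγ
  obtain ⟨C, T, hC, hcorr⟩ := hdecay.exists_bound (γ := γ) (by positivity)
  refine ae_eventually_le_rpow_neg (τ := fun x l => hittingTime Φ x (target V f l))
    hittingTime_anti (K := 1 + C * (1 + c⁻¹) ^ 2) (δ := δ) (b := b + 3 * δ) (c := 2) hδ
    (by linarith) (by linarith) two_pos ?_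
  filter_upwards [hthick, h, Ioo_mem_nhdsGT one_pos,
    eventually_mul_rpow_le_rpow T (neg_neg_of_pos hδ),
    eventually_mul_rpow_le_rpow (2 + ε) (a := -(b + 3 * δ)) (b := -(b + 2 * δ)) (by linarith)]
    with l hthick hl ⟨hl0, hl1⟩ hT htime
  rw [Real.rpow_zero, mul_one] at hT
  set A := Φ (ε / 4) ⁻¹' flowCylinder Φ V f (ε / 2) l with hA
  have hcl : 0 < c * l := by positivity
  set u : M → ℝ := fun x => (thickenedIndicator hcl A x : ℝ) with hu
  have hulip : LipschitzWith (c * l).toNNReal⁻¹ u :=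
    LipschitzWith.of_dist_le_mul fun x y =>
      (lipschitzWith_thickenedIndicator hcl A).dist_le_mul x y
  have hu0 : ∀ x, 0 ≤ u x := fun x => NNReal.coe_nonneg _
  have hu1 : ∀ x, u x ≤ 1 := fun x => by exact_mod_cast thickenedIndicator_le_one hcl A x
  set s := l ^ (-δ) with hs
  have hs0 : 0 < s := Real.rpow_pos_of_pos hl0 _
  have hlb := Real.rpow_pos_of_pos hl0 b
  have hm : l ^ b ≤ ∫ x, u x ∂μ := by
    have hint : Integrable u μ :=
      Integrable.of_bound hulip.continuous.measurable.aestronglyMeasurable 1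
        (ae_of_all _ fun x => by rw [Real.norm_of_nonneg (hu0 x)]; exact hu1 x)
    have h1 := mul_meas_ge_le_integral_of_nonneg (ae_of_all μ hu0) hint 1
    rw [one_mul] at h1
    refine le_trans ?_ h1
    rw [measureReal_def, ← ENNReal.ofReal_le_iff_le_toReal (measure_ne_top _ _)]
    rw [← measure_flow_preimage hμ (ε / 4)] at hl
    refine hl.trans (measure_mono fun x hx => ?_)
    exact NNReal.one_le_coe.2 (thickenedIndicator_one hcl A hx).ge
  set κ := C * (1 + ((c * l).toNNReal⁻¹ : ℝ≥0)) ^ 2 * s ^ (-γ) with hκ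
  have hκ0 : 0 ≤ κ := by positivity
  have hν : 0 < l ^ (-(b + δ)) := Real.rpow_pos_of_pos hl0 _
  set n := ⌈l ^ (-(b + δ))⌉₊ with hn
  have hZ := measureReal_forall_flow_eq_zero_le_add hμ hulip.continuous hu0 hu1 hs0.le hκ0
    (fun t ht => hcorr u _ hulip hu0 hu1 s t hs0 hT ht) hlb hm hν (Nat.le_ceil _)
  set Z := {x | ∀ i < n, u (Φ ((i + 1 : ℕ) * s) x) = 0} with hZdef
  have hZ' : μ.real Z ≤ (1 + C * (1 + c⁻¹) ^ 2) * l ^ δ := by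
    refine hZ.trans ?_
    have e1 : 1 / (l ^ (-(b + δ)) * l ^ b) = l ^ δ := by
      rw [← Real.rpow_add hl0, one_div, ← Real.rpow_neg hl0.le]; congr 1; ring
    have e2 : s ^ (-γ) = l ^ (2 + 2 * b + δ) := by
      rw [hs, ← Real.rpow_mul hl0.le, hγ]; congr 1; field_simp
    have e3 : (1 + (((c * l).toNNReal⁻¹ : ℝ≥0) : ℝ)) ≤ (1 + c⁻¹) * l⁻¹ := by
      rw [NNReal.coe_inv, Real.coe_toNNReal _ hcl.le, mul_inv, add_mul, one_mul]
      have := (one_le_inv₀ hl0).2 hl1.le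
      linarith
    have e4 : κ ≤ C * ((1 + c⁻¹) * l⁻¹) ^ 2 * l ^ (2 + 2 * b + δ) := by
      rw [hκ, e2]; gcongr
    have e5 : C * ((1 + c⁻¹) * l⁻¹) ^ 2 * l ^ (2 + 2 * b + δ) / (l ^ b) ^ 2 =
        C * (1 + c⁻¹) ^ 2 * l ^ δ := by
      have : l ^ (2 + 2 * b + δ) = l ^ 2 * (l ^ b) ^ 2 * l ^ δ := by
        rw [← Real.rpow_natCast (l ^ b), ← Real.rpow_mul hl0.le, ← Real.rpow_natCast l 2,
          ← Real.rpow_add hl0, ← Real.rpow_add hl0]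
        congr 1; push_cast; ring
      rw [this]; field_simp
    calc 1 / (l ^ (-(b + δ)) * l ^ b) + κ / (l ^ b) ^ 2
        ≤ l ^ δ + C * ((1 + c⁻¹) * l⁻¹) ^ 2 * l ^ (2 + 2 * b + δ) / (l ^ b) ^ 2 := by
          rw [e1]; gcongr
      _ = _ := by rw [e5]; ring
  -- A nonzero sample would put the orbit in the cylinder over `B_{2l}`, forcing a hit within a
  -- further `ε`; so a late hitting time means that all samples vanish.
  refine le_trans (measure_mono ?_) (ENNReal.le_ofReal_iff_toReal_le (measure_ne_top μ Z)
    (by positivity) |>.2 hZ')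
  intro x hx i hi
  by_contra hne
  have hmem : Φ ((i + 1 : ℕ) * s) x ∈ flowCylinder Φ V f ε (2 * l) := by
    refine hthick ?_
    by_contra hnot
    exact hne ((congrArg NNReal.toReal (thickenedIndicator_zero hcl A hnot)).trans NNReal.coe_zero)
  have hpos : 0 < ((i + 1 : ℕ) : ℝ) * s := by positivity
  refine (not_le.2 (show _ < _ from hx)) ((hittingTime_le_of_mem_flowCylinder hpos hmem).trans
    (ENNReal.ofReal_le_ofReal ?_))
  have hin : ((i + 1 : ℕ) : ℝ) ≤ l ^ (-(b + δ)) + 1 := by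
    have h1 : ((i + 1 : ℕ) : ℝ) ≤ n := by exact_mod_cast hi
    exact h1.trans (Nat.ceil_lt_add_one hν.le).le
  have f1 : l ^ (-(b + δ)) * s = l ^ (-(b + 2 * δ)) := by
    rw [hs, ← Real.rpow_add hl0]; congr 1; ring
  have f2 : s ≤ l ^ (-(b + 2 * δ)) :=
    Real.rpow_le_rpow_of_exponent_ge hl0 hl1.le (by linarith)
  have f3 : 1 ≤ l ^ (-(b + 2 * δ)) :=
    Real.one_le_rpow_of_pos_of_le_one_of_nonpos hl0 hl1.le (by linarith)
  calc ((i + 1 : ℕ) : ℝ) * s + ε ≤ (l ^ (-(b + δ)) + 1) * s + ε := by gcongr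
    _ = l ^ (-(b + 2 * δ)) + s + ε := by rw [add_mul, f1, one_mul]
    _ ≤ (2 + ε) * l ^ (-(b + 2 * δ)) := by nlinarith
    _ ≤ _ := htime

end Bounds

/-! ### Conclusion: the two bounds at rational exponents -/

theorem mainTheorem2
    {E : Type*} [NormedAddCommGroup E] [NormedSpace ℝ E] [FiniteDimensional ℝ E]
    {M : Type*} [MetricSpace M] [ChartedSpace E M] [IsManifold 𝓘(ℝ, E) 1 M]
    (hdist : IsLipschitzManifoldDist E M)
    [MeasurableSpace M] [BorelSpace M]
    -- the flow and the invariant probability measure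
    (Φ : Flow ℝ M) (hΦ : IsC1Flow E Φ)
    (μ : Measure M) [IsProbabilityMeasure μ] (hμ : ∀ t : ℝ, MeasurePreserving (Φ t) μ μ)
    (hdecay : HasSuperpolynomialDecay Φ μ)
    -- the transverse embedded submanifold `V = range ι`
    {E' : Type*} [NormedAddCommGroup E'] [NormedSpace ℝ E'] [FiniteDimensional ℝ E']
    {N : Type*} [TopologicalSpace N] [ChartedSpace E' N] [IsManifold 𝓘(ℝ, E') 1 N]
    (ι : N → M) (hι : Manifold.IsSmoothEmbedding 𝓘(ℝ, E') 𝓘(ℝ, E) 1 ι)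
    (hV : IsTransverseToFlow E E' Φ ι)
    -- the Lipschitz function defining the targets
    (f : M → ℝ) (hf_nonneg : ∀ x, 0 ≤ f x) (hf : ∃ K : ℝ≥0, LipschitzWith K f)
    (hcpt : ∃ l : ℝ, 0 < l ∧ IsCompact (closure (target (range ι) f l)) ∧
      closure (target (range ι) f l) ⊆ range ι)
    -- existence of the iterated limit
    (dε : ℝ → EReal) (d : EReal)
    (hinner : ∀ᶠ ε in 𝓝[>] (0 : ℝ), Tendsto
      (fun l : ℝ => ENNReal.log (μ (flowCylinder Φ (range ι) f ε l)) / ((Real.log l : ℝ) : EReal))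
      (𝓝[>] 0) (𝓝 (dε ε)))
    (houter : Tendsto dε (𝓝[>] 0) (𝓝 d)) :
    ∀ᵐ x ∂μ, Tendsto
      (fun l : ℝ => ENNReal.log (hittingTime Φ x (target (range ι) f l)) /
        ((-Real.log l : ℝ) : EReal))
      (𝓝[>] 0) (𝓝 d) := by
  have hsmall : ∀ᶠ l : ℝ in 𝓝[>] 0, 0 < l ∧ l < 1 := Ioo_mem_nhdsGT one_pos
  have hlower : ∀ q : ℚ, ((q : ℝ) : EReal) < d → ∀ᵐ x ∂μ, ∀ᶠ l : ℝ in 𝓝[>] 0,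
      ((q : ℝ) : EReal) ≤ ENNReal.log (hittingTime Φ x (target (range ι) f l)) /
        ((-Real.log l : ℝ) : EReal) := by
    intro q hq
    suffices h : ∀ᵐ x ∂μ, ∀ᶠ l : ℝ in 𝓝[>] 0,
        ENNReal.ofReal (l ^ (-(q : ℝ))) ≤ hittingTime Φ x (target (range ι) f l) by
      filter_upwards [h] with x hx
      filter_upwards [hx, hsmall] with l hl hl1
      exact le_log_div_neg_log_of_rpow_le hl1.1 hl1.2 hl
    -- For `q < 0` the threshold `l ^ (-q)` tends to 0 and positivity of one hitting time suffices.
    rcases lt_or_ge (q : ℝ) 0 with hq0 | hq0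
    · obtain ⟨l₀, hl₀, -, hl₀V⟩ := hcpt
      refine ae_of_all _ fun x => ?_
      have hpos := hittingTime_pos hdist hΦ hι hV hl₀V x
      have hlim : Tendsto (fun l : ℝ => ENNReal.ofReal (l ^ (-(q : ℝ)))) (𝓝[>] 0) (𝓝 0) := by
        have h1 := (Real.continuousAt_rpow_const 0 (-(q : ℝ)) (Or.inr (by linarith))).tendsto
        rw [Real.zero_rpow (by linarith)] at h1
        have h2 := ENNReal.tendsto_ofReal (h1.mono_left (nhdsWithin_le_nhds (s := Ioi 0)))
        rwa [ENNReal.ofReal_zero] at h2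
      filter_upwards [hlim.eventually_lt_const hpos, Ioo_mem_nhdsGT hl₀] with l h1 h2
      exact h1.le.trans (hittingTime_anti x h2.2.le)
    · obtain ⟨q', hqq', hq'⟩ := EReal.lt_iff_exists_real_btwn.1 hq
      obtain ⟨ε, ⟨hε, hεd⟩, hε0⟩ := ((hinner.and (houter.eventually_const_lt hq')).and
        self_mem_nhdsWithin).exists
      refine ae_eventually_rpow_neg_le_hittingTime hμ hε0 hq0 (EReal.coe_lt_coe_iff.1 hqq') ?_
      filter_upwards [hε.eventually_const_lt hεd, hsmall] with l h1 h2
      exact le_rpow_of_lt_log_div_log h2.1 h2.2 h1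
  have hupper : ∀ q : ℚ, d < ((q : ℝ) : EReal) → ∀ᵐ x ∂μ, ∀ᶠ l : ℝ in 𝓝[>] 0,
      ENNReal.log (hittingTime Φ x (target (range ι) f l)) / ((-Real.log l : ℝ) : EReal) ≤
        ((q : ℝ) : EReal) := by
    intro q hq
    obtain ⟨q', hq', hqq'⟩ := EReal.lt_iff_exists_real_btwn.1 hq
    obtain ⟨ε₀, c, hε₀, hc, hthick⟩ :=
      exists_thickening_subset_flowCylinder hdist hΦ hι hV hf hcpt
    -- The measure bound is needed for the half-height cylinder, so the full height is `2 * η`,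
    -- which must stay below `ε₀`.
    obtain ⟨η, ⟨hη, hηd⟩, hη0, hηε⟩ := ((hinner.and (houter.eventually_lt_const hq')).and
      (Ioo_mem_nhdsGT (half_pos hε₀))).exists
    have hmeas : ∀ᶠ l : ℝ in 𝓝[>] 0,
        ENNReal.ofReal (l ^ q') ≤ μ (flowCylinder Φ (range ι) f η l) := by
      filter_upwards [hη.eventually_lt_const hηd, hsmall] with l h1 h2
      exact rpow_le_of_log_div_log_lt h2.1 h2.2 h1
    -- A negative exponent would make `l ^ q'` exceed the total mass 1.
    have hq'0 : 0 ≤ q' := by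
      obtain ⟨l, hl, hl0, hl1⟩ := (hmeas.and hsmall).exists
      by_contra! hneg
      have h1 := Real.one_lt_rpow_of_pos_of_lt_one_of_neg hl0 hl1 hneg
      exact h1.not_ge (ENNReal.ofReal_le_one.1 (hl.trans prob_le_one))
    have h2η : 2 * η / 2 = η := by ring
    have h := ae_eventually_hittingTime_le_rpow_neg hμ hdecay (ε := 2 * η) (by linarith) hc hq'0
      (EReal.coe_lt_coe_iff.1 hqq') (hthick (2 * η) (by linarith) (by linarith)) (h2η.symm ▸ hmeas)
    filter_upwards [h] with x hx
    filter_upwards [hx, hsmall] with l hl hl1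
    exact log_div_neg_log_le_of_le_rpow hl1.1 hl1.2 hl
  -- Only countably many rational levels occur, so one null set serves them all.
  filter_upwards [ae_all_iff.2 fun q : ℚ => eventually_imp_distrib_left.2 (hlower q),
    ae_all_iff.2 fun q : ℚ => eventually_imp_distrib_left.2 (hupper q)] with x hx1 hx2
  refine tendsto_order.2 ⟨fun a ha => ?_, fun a ha => ?_⟩
  · obtain ⟨q, haq, hqd⟩ := EReal.lt_iff_exists_rat_btwn.1 ha
    filter_upwards [hx1 q hqd] with l hl using haq.trans_le hl
  · obtain ⟨q, hdq, hqa⟩ := EReal.lt_iff_exists_rat_btwn.1 ha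
    filter_upwards [hx2 q hdq] with l hl using hl.trans_lt hqa
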